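/- Let $D\ge 0$ be an integer and let $\mathcal P_2(\mathbb R^D)$ be the set of Borel probability measures on $\mathbb R^D$ with finite second moment, equipped with the 2-Wasserstein distance $W_2$, where $W_2^2(\mu,\nu)=\inf_\pi \int \|x-y\|^2\,\mathrm d\pi(x,y)$ over all couplings $\pi$ of $\mu$ and $\nu$. Fix $\zeta\in(0,1]$ and let $Q$ be a Borel probability measure on $(\mathcal P_2(\mathbb R^D),W_2)$ that is supported on centered non-degenerate Gaussian measures whose covariance matrices $\Sigma$ satisfy $\|\Sigma\|_{\mathrm{op}}\le 1$ and $\det\Sigma\ge\zeta$. Let $G(b)=\frac12\int W_2^2(b,\mu)\,\mathrm dQ(\mu)$ for $b\in\mathcal P_2(\mathbb R^D)$; a barycenter of $Q$ is a minimizer of $G$ over $\mathcal P_2(\mathbb R^D)$. Then $Q$ has a unique barycenter $\bar b$, and $\bar b$ is absolutely continuous with respect to Lebesgue measure. Moreover, let $b_0\in\operatorname{supp} Q$, let $\Sigma_0$ be the covariance matrix of $b_0$, and define Bures–Wasserstein gradient descent for $t\ge1$ by $$S_t=\int \Sigma_{t-1}^{-1/2}\bigl(\Sigma_{t-1}^{1/2}\,\Sigma(\mu)\,\Sigma_{t-1}^{1/2}\bigr)^{1/2}\Sigma_{t-1}^{-1/2}\,\mathrm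 dQ(\mu),\qquad \Sigma_t=S_t\,\Sigma_{t-1}\,S_t,$$ where $\Sigma(\mu)$ is the covariance matrix of $\mu$, and let $b_t$ be the centered Gaussian measure with covariance matrix $\Sigma_t$. Then every step is well defined (each $\Sigma_t$ is positive definite and the matrix-valued integrand is $Q$-integrable), and for every integer $T\ge0$ $$W_2^2(b_T,\bar b)\le\frac{2}{\zeta}\Bigl(1-\frac{\zeta^2}{4}\Bigr)^T\,[G(b_0)-G(\bar b)].$$ -/

import Mathlib

open MeasureTheory ProbabilityTheory
open scoped ENNReal

namespace BuresBarycenter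

noncomputable section

/-- The space of Borel probability measures on Euclidean `ℝ^D` with finite second moment. -/
def P2 (D : ℕ) : Type :=
  {μ : Measure (EuclideanSpace ℝ (Fin D)) // IsProbabilityMeasure μ ∧ MemLp id 2 μ}

/-- The measure underlying an element of `P2 D`. -/
def P2.toMeasure {D : ℕ} (μ : P2 D) : Measure (EuclideanSpace ℝ (Fin D)) := μ.1

/-- The couplings of two measures: the measures on the product with these marginals. -/
def couplings {D : ℕ} (μ ν : P2 D) :
    Set (Measure (EuclideanSpace ℝ (Fin D) × EuclideanSpace ℝ (Fin D))) :=
  {π | π.fst = μ.toMeasure ∧ π.snd = ν.toMeasure}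

/-- The squared 2-Wasserstein distance. It is finite, as the second moments are. -/
def W2sq {D : ℕ} (μ ν : P2 D) : ℝ≥0∞ :=
  ⨅ π ∈ couplings μ ν, ∫⁻ p, edist p.1 p.2 ^ 2 ∂π

/-- The metric topology of the 2-Wasserstein distance: a set is open if and only if it contains
a Wasserstein ball around each of its points. -/
instance (D : ℕ) : TopologicalSpace (P2 D) where
  IsOpen U := ∀ μ ∈ U, ∃ r : ℝ≥0∞, 0 < r ∧ ∀ ν, W2sq μ ν < r ^ 2 → ν ∈ U
  isOpen_univ := fun _ _ => ⟨1, one_pos, fun _ _ => Set.mem_univ _⟩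
  isOpen_inter := by
    rintro U V hU hV μ ⟨hμU, hμV⟩
    obtain ⟨r, hr, hrU⟩ := hU μ hμU
    obtain ⟨s, hs, hsV⟩ := hV μ hμV
    refine ⟨min r s, lt_min hr hs, fun ν hν => ⟨hrU ν ?_, hsV ν ?_⟩⟩
    · exact hν.trans_le (pow_le_pow_left' (min_le_left r s) 2)
    · exact hν.trans_le (pow_le_pow_left' (min_le_right r s) 2)
  isOpen_sUnion := by
    rintro S hS μ ⟨U, hU, hμU⟩
    obtain ⟨r, hr, hrU⟩ := hS U hU μ hμU
    exact ⟨r, hr, fun ν hν => ⟨U, hU, hrU ν hν⟩⟩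

/-- The Borel σ-algebra of the Wasserstein topology. -/
instance (D : ℕ) : MeasurableSpace (P2 D) := borel (P2 D)

instance (D : ℕ) : BorelSpace (P2 D) := ⟨rfl⟩

/-- The barycenter functional `G(b) = (1/2) ∫ W₂²(b, μ) dQ(μ)`. -/
def G {D : ℕ} (Q : Measure (P2 D)) (b : P2 D) : ℝ≥0∞ :=
  (1 / 2) * ∫⁻ μ, W2sq b μ ∂Q

/-- A barycenter of `Q` is a minimizer of the barycenter functional over `P2 D`. -/
def IsBarycenter {D : ℕ} (Q : Measure (P2 D)) (b : P2 D) : Prop :=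
  ∀ b' : P2 D, G Q b ≤ G Q b'

/-- The centered Gaussian measure with covariance matrix `S` (positive semidefinite). -/
def gaussian {D : ℕ} (S : Matrix (Fin D) (Fin D) ℝ) : P2 D :=
  ⟨multivariateGaussian 0 S, inferInstance, IsGaussian.memLp_two_id⟩

/-- The centered Gaussians whose covariance matrix is positive definite, has operator norm at
most `1` and determinant at least `ζ`. -/
def regularGaussians (D : ℕ) (ζ : ℝ) : Set (P2 D) :=
  {μ | ∃ S : Matrix (Fin D) (Fin D) ℝ, S.PosDef ∧
    ‖Matrix.toEuclideanCLM (n := Fin D) (𝕜 := ℝ) S‖ ≤ 1 ∧ ζ ≤ S.det ∧ μ = gaussian S}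

/-- The covariance matrix of a measure. -/
def covMatrix {D : ℕ} (μ : P2 D) : Matrix (Fin D) (Fin D) ℝ :=
  Matrix.of fun i j => cov[fun x => x i, fun x => x j; μ.toMeasure]

section
open scoped MatrixOrder

/-- The matrix `A^{-1/2} (A^{1/2} B A^{1/2})^{1/2} A^{-1/2}` of the optimal transport map from the
centered Gaussian with covariance `A` to the one with covariance `B`. -/
def transportMatrix {D : ℕ} (A B : Matrix (Fin D) (Fin D) ℝ) : Matrix (Fin D) (Fin D) ℝ :=
  (CFC.sqrt A)⁻¹ * CFC.sqrt (CFC.sqrt A * B * CFC.sqrt A) * (CFC.sqrt A)⁻¹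

end

/-- The average over `μ ∼ Q` of the transport matrices from covariance `A` to that of `μ`. -/
def meanTransport {D : ℕ} (Q : Measure (P2 D)) (A : Matrix (Fin D) (Fin D) ℝ) :
    Matrix (Fin D) (Fin D) ℝ :=
  Matrix.of fun i j => ∫ μ, transportMatrix A (covMatrix μ) i j ∂Q

/-- Bures-Wasserstein gradient descent: the covariance matrix after `T` steps from `S₀`. -/
def buresGD {D : ℕ} (Q : Measure (P2 D)) (S₀ : Matrix (Fin D) (Fin D) ℝ) :
    ℕ → Matrix (Fin D) (Fin D) ℝ
  | 0 => S₀
  | t + 1 => meanTransport Q (buresGD Q S₀ t) * buresGD Q S₀ t * meanTransport Q (buresGD Q S₀ t)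

end

end BuresBarycenter

/-! Everything takes place in the set of `Regular` covariances: positive definite, at most `1`, with
determinant at least `ζ`. It is compact. Its eigenvalues are at most `1` with product at least `ζ`,
so each is at least `ζ`. The transport matrix `T` from `A` to `B` satisfies `T * A * T = B`; for
regular `A`, `B` this forces `T ≥ ζ`.

The key estimate is Kantorovich duality with quadratic potentials (`dual_le_W2sq`). Completing the
square keeps a deficit, which `T ≥ ζ` bounds below by `ζ` times a squared distance to the Gaussian
of covariance `A`. Write `F` for `meanBuresSq Q`, which is `2G` on Gaussians, and `S` for
`meanTransport Q A`. Averaging over `Q` (`le_G`) gives, for every `b` in `P2 D`, `2G(b) ≥ F(A) +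
tr((1 - S)(M_b - A)) + ζ W₂²(b, γ_A)`, where `M_b` is the second moment matrix of `b` and `γ_A` the
centered Gaussian of covariance `A`. When `S = 1` the linear term vanishes, so `γ_A` is the unique
barycenter and `ζ W₂²(b, γ_A) ≤ 2(G(b) - G(γ_A))`.

A descent step preserves regularity (`regular_step`): the upper bound by convexity of `T ↦ T * A *
T`, the determinant bound by concavity of `log det`. The step lowers `F` by at least `g = tr((1 - S)
A (1 - S))` (`meanBuresSq_step_le`). Hence a minimizer of `F` over the compact regular set has `g =
0`, that is `S = 1`, which produces the barycenter.

For the rate, the linear term of `le_G` at another regular Gaussian is absorbed by Young's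
inequality (`gradient_lower_bound`). This yields the Polyak-Łojasiewicz inequality `ζ² (F(A) - F(B))
≤ g`, so the excess of `F` decays geometrically, and the growth bound above converts it into a bound
on `W₂²`. -/

namespace BuresBarycenter

open Matrix
open scoped MatrixOrder Topology

/-! ### Regular covariance matrices, square roots and trace inequalities -/

section MatrixLemmas

variable {n : Type*} [Fintype n] [DecidableEq n]

/-- The positive definite matrices `A ≤ 1` with determinant at least `ζ`. -/
def Regular (ζ : ℝ) (A : Matrix n n ℝ) : Prop :=
  A.PosDef ∧ (1 - A).PosSemidef ∧ ζ ≤ A.det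

omit [DecidableEq n] in
theorem posSemidef_iff_real {M : Matrix n n ℝ} :
    M.PosSemidef ↔ Mᵀ = M ∧ ∀ x : n → ℝ, 0 ≤ x ⬝ᵥ M *ᵥ x := by
  rw [posSemidef_iff_dotProduct_mulVec]
  simp [IsHermitian, conjTranspose_eq_transpose_of_trivial]

omit [DecidableEq n] in
theorem posDef_iff_real {M : Matrix n n ℝ} :
    M.PosDef ↔ Mᵀ = M ∧ ∀ x : n → ℝ, x ≠ 0 → 0 < x ⬝ᵥ M *ᵥ x := by
  rw [posDef_iff_dotProduct_mulVec]
  simp [IsHermitian, conjTranspose_eq_transpose_of_trivial]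

omit [DecidableEq n] in
theorem transpose_eq_of_posDef {M : Matrix n n ℝ} (h : M.PosDef) : Mᵀ = M :=
  (posDef_iff_real.1 h).1

omit [DecidableEq n] in
theorem transpose_eq_of_posSemidef {M : Matrix n n ℝ} (h : M.PosSemidef) : Mᵀ = M :=
  (posSemidef_iff_real.1 h).1

omit [DecidableEq n] in
theorem posSemidef_conj {A B : Matrix n n ℝ} (hA : A.PosSemidef) (hB : Bᵀ = B) :
    (B * A * B).PosSemidef := by
  have := hA.mul_mul_conjTranspose_same B
  rwa [conjTranspose_eq_transpose_of_trivial, hB] at this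

theorem posDef_conj {A B : Matrix n n ℝ} (hA : A.PosDef) (hB : B.PosDef) :
    (B * A * B).PosDef := by
  have h := posSemidef_conj hA.posSemidef (transpose_eq_of_posDef hB)
  rw [h.posDef_iff_isUnit]
  exact (hB.isUnit.mul hA.isUnit).mul hB.isUnit

theorem sub_smul_one_posSemidef {A : Matrix n n ℝ} (hA : A.IsHermitian) {c : ℝ}
    (h : ∀ i, c ≤ hA.eigenvalues i) : (A - c • (1 : Matrix n n ℝ)).PosSemidef := by
  have : algebraMap ℝ (Matrix n n ℝ) c ≤ A := by
    rw [algebraMap_le_iff_le_spectrum (ha := hA), hA.spectrum_real_eq_range_eigenvalues]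
    rintro _ ⟨i, rfl⟩
    exact h i
  rwa [Algebra.algebraMap_eq_smul_one, le_iff] at this

theorem eigenvalues_le_one {A : Matrix n n ℝ} (hA : A.IsHermitian)
    (h : (1 - A).PosSemidef) (i : n) : hA.eigenvalues i ≤ 1 := by
  have h1 : A ≤ algebraMap ℝ (Matrix n n ℝ) 1 := by rw [le_iff]; simpa using h
  rw [le_algebraMap_iff_spectrum_le (ha := hA), hA.spectrum_real_eq_range_eigenvalues] at h1
  exact h1 _ ⟨i, rfl⟩

/-- The determinant is the product of eigenvalues lying in `(0, 1]`, so it is at most each single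
eigenvalue. -/
theorem Regular.sub_smul_one_posSemidef {ζ : ℝ} {A : Matrix n n ℝ} (h : Regular ζ A) :
    (A - ζ • (1 : Matrix n n ℝ)).PosSemidef := by
  have hA := h.1.1
  refine BuresBarycenter.sub_smul_one_posSemidef hA fun i => h.2.2.trans ?_
  rw [hA.det_eq_prod_eigenvalues, ← Finset.mul_prod_erase _ _ (Finset.mem_univ i)]
  refine mul_le_of_le_one_right (h.1.eigenvalues_pos i).le ?_
  exact Finset.prod_le_one (fun j _ => (h.1.eigenvalues_pos j).le)
    fun j _ => eigenvalues_le_one hA h.2.1 j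

omit [DecidableEq n] in
theorem isClosed_posSemidef : IsClosed {A : Matrix n n ℝ | A.PosSemidef} := by
  have : {A : Matrix n n ℝ | A.PosSemidef} =
      {A | Aᵀ = A} ∩ ⋂ x : n → ℝ, {A | 0 ≤ x ⬝ᵥ A *ᵥ x} := by
    ext A; simp [posSemidef_iff_real]
  rw [this]
  refine IsClosed.inter (isClosed_eq (by fun_prop) (by fun_prop)) (isClosed_iInter fun x => ?_)
  exact isClosed_le (by fun_prop) (by fun_prop)

theorem abs_apply_le_one {A : Matrix n n ℝ} (h : A.PosSemidef) (h1 : (1 - A).PosSemidef)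
    (i j : n) : |A i j| ≤ 1 := by
  obtain ⟨ht, hx⟩ := posSemidef_iff_real.1 h
  have hd : ∀ k, A k k ≤ 1 := fun k => by
    have := h1.diag_nonneg (i := k); simpa using this
  have hs : A j i = A i j := congr_fun (congr_fun ht i) j
  have hp := hx (Pi.single i 1 + Pi.single j 1)
  have hm := hx (Pi.single i 1 - Pi.single j 1)
  simp [mulVec_add, mulVec_sub, dotProduct_add, dotProduct_sub, add_dotProduct,
    sub_dotProduct] at hp hm
  rw [abs_le]
  constructor <;> linarith [hd i, hd j]

/-- Positive definiteness is not a closed condition, but semidefiniteness is, and the determinant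
bound `ζ > 0` restores definiteness in the limit. -/
theorem isCompact_regular {ζ : ℝ} (hζ : 0 < ζ) : IsCompact {A : Matrix n n ℝ | Regular ζ A} := by
  have hK : IsCompact (Set.univ.pi fun _ : n => Set.univ.pi fun _ : n => Set.Icc (-1 : ℝ) 1) :=
    isCompact_univ_pi fun _ => isCompact_univ_pi fun _ => isCompact_Icc
  refine IsCompact.of_isClosed_subset (hK : IsCompact (X := Matrix n n ℝ) _) ?_ ?_
  · have : {A : Matrix n n ℝ | Regular ζ A} =
        {A | A.PosSemidef} ∩ ((fun A => 1 - A) ⁻¹' {A | A.PosSemidef}) ∩ {A | ζ ≤ A.det} := by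
      ext A
      simp only [Regular, Set.mem_ofPred_eq, Set.mem_inter_iff, Set.mem_preimage]
      constructor
      · rintro ⟨h1, h2, h3⟩
        exact ⟨⟨h1.posSemidef, h2⟩, h3⟩
      · rintro ⟨⟨h1, h2⟩, h3⟩
        exact ⟨h1.posDef_iff_det_ne_zero.2 (hζ.trans_le h3).ne', h2, h3⟩
    rw [this]
    exact (isClosed_posSemidef.inter (isClosed_posSemidef.preimage (by fun_prop))).inter
      (isClosed_le (by fun_prop) (by fun_prop))
  · intro A hA i _ j _
    exact abs_le.1 (abs_apply_le_one hA.1.posSemidef hA.2.1 i j)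

theorem continuousOn_sqrt :
    ContinuousOn (CFC.sqrt : Matrix n n ℝ → Matrix n n ℝ) {A | A.PosSemidef} := by
  open scoped Matrix.Norms.L2Operator in
  exact ContinuousOn.cfcₙ_nnreal_of_mem_nhdsSet (s := Set.univ) NNReal.sqrt
    Filter.univ_mem continuousOn_id (fun A hA => nonneg_iff_posSemidef.2 hA)
    NNReal.continuous_sqrt.continuousOn

theorem posSemidef_sqrt (A : Matrix n n ℝ) : (CFC.sqrt A).PosSemidef :=
  nonneg_iff_posSemidef.1 (CFC.sqrt_nonneg A)

theorem sqrt_mul_sqrt {A : Matrix n n ℝ} (hA : A.PosSemidef) : CFC.sqrt A * CFC.sqrt A = A :=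
  CFC.sqrt_mul_sqrt_self A (nonneg_iff_posSemidef.2 hA)

theorem posDef_sqrt {A : Matrix n n ℝ} (hA : A.PosDef) : (CFC.sqrt A).PosDef := by
  rw [(posSemidef_sqrt A).posDef_iff_det_ne_zero]
  intro h
  have h2 := congr_arg det (sqrt_mul_sqrt hA.posSemidef)
  rw [det_mul, h, mul_zero] at h2
  exact hA.det_pos.ne h2

/-- The concavity of `log det`, in tangent form. -/
theorem log_det_sub_log_det_le {S T : Matrix n n ℝ} (hS : S.PosDef) (hT : T.PosDef) :
    Real.log T.det - Real.log S.det ≤ (S⁻¹ * T).trace - Fintype.card n := by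
  have hR := posDef_sqrt hS.inv
  set R := CFC.sqrt S⁻¹ with hRdef
  have hRR : R * R = S⁻¹ := sqrt_mul_sqrt hS.inv.posSemidef
  have hX := posDef_conj hT hR
  have htr : (S⁻¹ * T).trace = (R * T * R).trace := by
    rw [← hRR, Matrix.trace_mul_comm (R * T), mul_assoc]
  have hdet : (R * T * R).det = T.det / S.det := by
    have : R.det * R.det = (S.det)⁻¹ := by
      rw [← det_mul, hRR, det_nonsing_inv, Ring.inverse_eq_inv']
    rw [det_mul, det_mul, div_eq_mul_inv, ← this]; ring
  rw [← Real.log_div hT.det_pos.ne' hS.det_pos.ne', ← hdet, htr,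
    hX.1.det_eq_prod_eigenvalues, hX.1.trace_eq_sum_eigenvalues]
  simp only [RCLike.ofReal_real_eq_id, id]
  rw [Real.log_prod (fun i _ => (hX.eigenvalues_pos i).ne')]
  have : (Fintype.card n : ℝ) = ∑ _i : n, (1 : ℝ) := by simp
  rw [this, ← Finset.sum_sub_distrib]
  exact Finset.sum_le_sum fun i _ => Real.log_le_sub_one_of_pos (hX.eigenvalues_pos i)

/-- On a unit eigenvector `v` of `T` with eigenvalue `τ`, `ζ ≤ v ⬝ᵥ B *ᵥ v = τ² (v ⬝ᵥ A *ᵥ v) ≤ τ²`.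
Since `0 < ζ ≤ 1` or `ζ = 0`, this gives `τ ≥ √ζ ≥ ζ`. -/
theorem sub_smul_one_posSemidef_of_conj {A B T : Matrix n n ℝ} {ζ : ℝ} (hζ : 0 ≤ ζ) (hζ₁ : ζ ≤ 1)
    (hA : (1 - A).PosSemidef) (hB : (B - ζ • (1 : Matrix n n ℝ)).PosSemidef)
    (hT : T.PosDef) (h : T * A * T = B) : (T - ζ • (1 : Matrix n n ℝ)).PosSemidef := by
  refine sub_smul_one_posSemidef hT.1 fun i => ?_
  have hpos := hT.eigenvalues_pos i
  have hv := hT.1.mulVec_eigenvectorBasis i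
  set v : n → ℝ := (hT.1.eigenvectorBasis i).ofLp with hvdef
  set τ := hT.1.eigenvalues i
  have hnorm : v ⬝ᵥ v = 1 := by
    have h1 := hT.1.eigenvectorBasis.orthonormal.1 i
    have h2 := real_inner_self_eq_norm_sq (hT.1.eigenvectorBasis i)
    rw [h1, EuclideanSpace.inner_eq_star_dotProduct] at h2
    simpa using h2
  have h1 := (posSemidef_iff_real.1 hA).2 v
  have h2 := (posSemidef_iff_real.1 hB).2 v
  have h3 : v ⬝ᵥ B *ᵥ v = τ * τ * (v ⬝ᵥ A *ᵥ v) := by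
    rw [← h, ← mulVec_mulVec, ← mulVec_mulVec, hv, dotProduct_mulVec, ← mulVec_transpose,
      transpose_eq_of_posDef hT, hv, mulVec_smul, dotProduct_smul, smul_dotProduct]
    simp [mul_assoc]
  simp only [sub_mulVec, smul_mulVec, one_mulVec, dotProduct_sub, dotProduct_smul, hnorm,
    smul_eq_mul, h3] at h1 h2
  have : ζ ≤ τ * τ := by nlinarith [mul_nonneg hpos.le hpos.le]
  by_contra hlt
  push Not at hlt
  nlinarith

/-- The Polyak-Łojasiewicz estimate at the level of matrices: `M` carries `A` to `M * A * M`,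
and `H` is the gradient. -/
theorem gradient_lower_bound {A M H : Matrix n n ℝ} {ζ : ℝ} (hζ : 0 < ζ) (hζ₁ : ζ ≤ 1)
    (hA : A.PosSemidef) (hAζ : (A - ζ • (1 : Matrix n n ℝ)).PosSemidef)
    (hM : Mᵀ = M) (hH : Hᵀ = H) (hB : (1 - M * A * M).PosSemidef) :
    -((H * A * H).trace / ζ ^ 2) ≤
      (H * (M * A * M - A)).trace + ζ * ((1 - M) * A * (1 - M)).trace := by
  have hAt := transpose_eq_of_posSemidef hA
  have hsymm : (H * (M * A)).trace = (H * (A * M)).trace := by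
    rw [← trace_transpose (H * (M * A)), transpose_mul, transpose_mul, hM, hH, hAt,
      Matrix.trace_mul_comm]
  -- Young's inequality as a square in the inner product weighted by `A`. The weight `2 * ζ` makes
  -- the `(M - 1)` square, after division by `4 * ζ`, match the term with coefficient `ζ` in the
  -- goal.
  have hYoung : 0 ≤ ((H * (M + 1) + (2 * ζ) • (M - 1)) * A *
      ((M + 1) * H + (2 * ζ) • (M - 1))).trace := by
    have := hA.mul_mul_conjTranspose_same (H * (M + 1) + (2 * ζ) • (M - 1))
    simp only [conjTranspose_eq_transpose_of_trivial, transpose_add, transpose_mul, transpose_smul,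
      transpose_sub, transpose_one, hM, hH] at this
    exact this.trace_nonneg
  -- By the parallelogram law the left side is at most `2 tr(H(MAM + A)H)`; then `MAM ≤ 1` and `1 ≤
  -- A / ζ` bound both summands by `tr(HAH) / ζ`.
  have hbound : ((H * (M + 1)) * A * ((M + 1) * H)).trace ≤ 4 / ζ * (H * A * H).trace := by
    have h1 : 0 ≤ ((H * (M - 1)) * A * ((M - 1) * H)).trace := by
      have := hA.mul_mul_conjTranspose_same (H * (M - 1))
      simp only [conjTranspose_eq_transpose_of_trivial, transpose_mul,
        transpose_sub, transpose_one, hM, hH] at this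
      exact this.trace_nonneg
    have h2 := (posSemidef_conj hB hH).trace_nonneg
    have h3 := (posSemidef_conj hAζ hH).trace_nonneg
    have hA0 := (posSemidef_conj hA hH).trace_nonneg
    simp only [mul_add, add_mul, mul_sub, sub_mul, mul_one, one_mul, trace_add, trace_sub,
      mul_assoc, mul_smul_comm, smul_mul_assoc, trace_smul, smul_eq_mul] at h1 h2 h3 hA0 ⊢
    have h4 : (H * H).trace ≤ (H * (A * H)).trace / ζ := by
      rw [le_div_iff₀ hζ]; linarith
    have h5 : (H * (A * H)).trace ≤ (H * (A * H)).trace / ζ := by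
      rw [le_div_iff₀ hζ]; nlinarith
    have h6 : 4 / ζ * (H * (A * H)).trace = 4 * ((H * (A * H)).trace / ζ) := by ring
    rw [h6]
    linarith
  -- A noncommutative difference of squares: the cross terms cancel only under the trace, by
  -- `hsymm`.
  have hU : ((H * (M + 1)) * A * (M - 1)).trace = (H * (M * A * M - A)).trace := by
    simp only [mul_add, add_mul, mul_sub, mul_one, trace_add, trace_sub, mul_assoc] at hsymm ⊢
    linarith
  have hU1 : ((M - 1) * A * ((M + 1) * H)).trace = (H * (M * A * M - A)).trace := by
    rw [← hU, ← trace_transpose ((M - 1) * A * ((M + 1) * H))]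
    simp only [transpose_mul, transpose_add, transpose_sub, transpose_one, hM, hH, hAt, mul_assoc]
  have hX : ((M - 1) * A * (M - 1)).trace = ((1 - M) * A * (1 - M)).trace := by
    rw [← neg_sub 1 M, neg_mul, neg_mul, mul_neg, neg_neg]
  have hexp : ((H * (M + 1) + (2 * ζ) • (M - 1)) * A * ((M + 1) * H + (2 * ζ) • (M - 1))).trace =
      ((H * (M + 1)) * A * ((M + 1) * H)).trace + (2 * ζ) * ((H * (M + 1)) * A * (M - 1)).trace +
      (2 * ζ) * ((M - 1) * A * ((M + 1) * H)).trace +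
      (2 * ζ) ^ 2 * ((M - 1) * A * (M - 1)).trace := by
    rw [add_mul (H * (M + 1)), add_mul (H * (M + 1) * A), mul_add (H * (M + 1) * A),
      mul_add ((2 * ζ) • (M - 1) * A)]
    simp only [smul_mul_assoc, mul_smul_comm, trace_add, trace_smul, smul_eq_mul]
    ring
  rw [hexp, hU, hU1, hX] at hYoung
  have h7 : (H * A * H).trace / ζ ^ 2 * (4 * ζ) = 4 / ζ * (H * A * H).trace := by
    field_simp
  nlinarith

end MatrixLemmas

/-! ### The Gaussian transport matrix and the Bures-Wasserstein formula -/

section Transport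

variable {D : ℕ} {A B : Matrix (Fin D) (Fin D) ℝ}

theorem posDef_transportMatrix (hA : A.PosDef) (hB : B.PosDef) : (transportMatrix A B).PosDef :=
  posDef_conj (posDef_sqrt (posDef_conj hB (posDef_sqrt hA))) (posDef_sqrt hA).inv

theorem transportMatrix_mul_mul (hA : A.PosDef) (hB : B.PosDef) :
    transportMatrix A B * A * transportMatrix A B = B := by
  have hR := posDef_sqrt hA
  have hRR := sqrt_mul_sqrt hA.posSemidef
  have hXX := sqrt_mul_sqrt (posDef_conj hB hR).posSemidef
  have hdet : IsUnit (CFC.sqrt A).det := hR.det_pos.ne'.isUnit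
  unfold transportMatrix
  set R := CFC.sqrt A
  set X := CFC.sqrt (R * B * R)
  calc R⁻¹ * X * R⁻¹ * A * (R⁻¹ * X * R⁻¹) = R⁻¹ * X * (R⁻¹ * R) * (R * R⁻¹) * X * R⁻¹ := by
        rw [← hRR]; simp only [mul_assoc]
    _ = R⁻¹ * (X * X) * R⁻¹ := by
        rw [nonsing_inv_mul _ hdet, mul_nonsing_inv _ hdet]; simp only [mul_one, mul_assoc]
    _ = (R⁻¹ * R) * B * (R * R⁻¹) := by rw [hXX]; simp only [mul_assoc]
    _ = B := by rw [nonsing_inv_mul _ hdet, mul_nonsing_inv _ hdet, one_mul, mul_one]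

theorem trace_transportMatrix_mul (hA : A.PosDef) :
    (transportMatrix A B * A).trace = (CFC.sqrt (CFC.sqrt A * B * CFC.sqrt A)).trace := by
  have hR := posDef_sqrt hA
  have hRR := sqrt_mul_sqrt hA.posSemidef
  have hdet : IsUnit (CFC.sqrt A).det := hR.det_pos.ne'.isUnit
  unfold transportMatrix
  set R := CFC.sqrt A
  set X := CFC.sqrt (R * B * R)
  have : R⁻¹ * X * R⁻¹ * A = R⁻¹ * X * R := by
    rw [← hRR, mul_assoc _ R⁻¹, ← mul_assoc R⁻¹, nonsing_inv_mul _ hdet, one_mul]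
  rw [this, Matrix.trace_mul_comm, ← mul_assoc, mul_nonsing_inv _ hdet, one_mul]

theorem Regular.transportMatrix_sub_posSemidef {ζ : ℝ} (hζ : 0 ≤ ζ) (hζ₁ : ζ ≤ 1)
    (hA : Regular ζ A) (hB : Regular ζ B) :
    (transportMatrix A B - ζ • (1 : Matrix (Fin D) (Fin D) ℝ)).PosSemidef :=
  sub_smul_one_posSemidef_of_conj hζ hζ₁ hA.2.1 hB.sub_smul_one_posSemidef
    (posDef_transportMatrix hA.1 hB.1) (transportMatrix_mul_mul hA.1 hB.1)

theorem continuousOn_transportMatrix (A : Matrix (Fin D) (Fin D) ℝ) :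
    ContinuousOn (transportMatrix A) {B | B.PosSemidef} := by
  have h : ContinuousOn (fun B => CFC.sqrt (CFC.sqrt A * B * CFC.sqrt A)) {B | B.PosSemidef} :=
    continuousOn_sqrt.comp (t := {B | B.PosSemidef}) (by fun_prop) fun B hB =>
      posSemidef_conj hB (transpose_eq_of_posSemidef (posSemidef_sqrt A))
  unfold transportMatrix
  exact (continuousOn_const.mul h).mul continuousOn_const

/-- The squared Bures-Wasserstein distance between two covariance matrices. -/
noncomputable def buresSq (A B : Matrix (Fin D) (Fin D) ℝ) : ℝ :=
  A.trace + B.trace - 2 * (CFC.sqrt (CFC.sqrt A * B * CFC.sqrt A)).trace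

theorem buresSq_eq (hA : A.PosDef) :
    buresSq A B = A.trace + B.trace - 2 * (transportMatrix A B * A).trace := by
  rw [buresSq, trace_transportMatrix_mul hA]

theorem buresSq_eq_trace (hA : A.PosDef) (hB : B.PosDef) :
    buresSq A B = ((1 - transportMatrix A B) * A * (1 - transportMatrix A B)).trace := by
  rw [buresSq_eq hA]
  simp only [sub_mul, mul_sub, one_mul, mul_one, transportMatrix_mul_mul hA hB, trace_sub]
  rw [Matrix.trace_mul_comm A]
  ring

theorem continuousOn_buresSq :
    ContinuousOn (fun p : Matrix (Fin D) (Fin D) ℝ × Matrix (Fin D) (Fin D) ℝ =>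
      buresSq p.1 p.2) ({A | A.PosSemidef} ×ˢ {B | B.PosSemidef}) := by
  have h1 : ContinuousOn (fun p : Matrix (Fin D) (Fin D) ℝ × Matrix (Fin D) (Fin D) ℝ =>
      CFC.sqrt p.1) ({A | A.PosSemidef} ×ˢ {B | B.PosSemidef}) :=
    continuousOn_sqrt.comp (t := {B | B.PosSemidef}) (by fun_prop) fun p hp => hp.1
  have h2 : ContinuousOn (fun p : Matrix (Fin D) (Fin D) ℝ × Matrix (Fin D) (Fin D) ℝ =>
      CFC.sqrt (CFC.sqrt p.1 * p.2 * CFC.sqrt p.1)) ({A | A.PosSemidef} ×ˢ {B | B.PosSemidef}) :=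
    continuousOn_sqrt.comp (t := {B | B.PosSemidef}) ((h1.mul continuousOn_snd).mul h1)
      fun p hp => posSemidef_conj hp.2 (transpose_eq_of_posSemidef (posSemidef_sqrt p.1))
  have htr : Continuous (trace : Matrix (Fin D) (Fin D) ℝ → ℝ) := by fun_prop
  unfold buresSq
  exact (((htr.comp continuous_fst).add (htr.comp continuous_snd)).continuousOn).sub
    (continuousOn_const.mul (htr.comp_continuousOn h2))

end Transport

/-! ### Couplings, moments and Wasserstein distances to Gaussians -/

section Wasserstein

variable {D : ℕ}

instance (μ : P2 D) : IsProbabilityMeasure μ.toMeasure := μ.2.1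

theorem P2.memLp (μ : P2 D) : MemLp id 2 μ.toMeasure := μ.2.2

theorem P2.memLp_apply (μ : P2 D) (i : Fin D) :
    MemLp (fun x : EuclideanSpace ℝ (Fin D) => x i) 2 μ.toMeasure :=
  μ.memLp.continuousLinearMap_comp (EuclideanSpace.proj i : EuclideanSpace ℝ (Fin D) →L[ℝ] ℝ)

theorem P2.integrable_mul (μ : P2 D) (i j : Fin D) :
    Integrable (fun x : EuclideanSpace ℝ (Fin D) => x i * x j) μ.toMeasure :=
  (μ.memLp_apply i).integrable_mul (μ.memLp_apply j)

/-- The matrix of second moments of a measure. -/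
noncomputable def secondMoment (μ : P2 D) : Matrix (Fin D) (Fin D) ℝ :=
  Matrix.of fun i j => ∫ x, x i * x j ∂μ.toMeasure

theorem P2.integrable_quadratic (μ : P2 D) (N : Matrix (Fin D) (Fin D) ℝ) :
    Integrable (fun x : EuclideanSpace ℝ (Fin D) => x.ofLp ⬝ᵥ N *ᵥ x.ofLp) μ.toMeasure := by
  simp only [dotProduct, mulVec, Finset.mul_sum]
  refine integrable_finsetSum _ fun i _ => integrable_finsetSum _ fun j _ => ?_
  refine ((μ.integrable_mul i j).const_mul (N i j)).congr (.of_forall fun x => ?_)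
  simp only; ring

theorem P2.integral_quadratic (μ : P2 D) (N : Matrix (Fin D) (Fin D) ℝ) :
    ∫ x, x.ofLp ⬝ᵥ N *ᵥ x.ofLp ∂μ.toMeasure = (N * secondMoment μ).trace := by
  have : ∀ x : EuclideanSpace ℝ (Fin D), x.ofLp ⬝ᵥ N *ᵥ x.ofLp =
      ∑ i, ∑ j, N i j * (x j * x i) := fun x => by
    simp only [dotProduct, mulVec, Finset.mul_sum]
    exact Finset.sum_congr rfl fun i _ => Finset.sum_congr rfl fun j _ => by ring
  simp only [this]
  rw [integral_finsetSum _ fun i _ => integrable_finsetSum _ fun j _ =>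
    (μ.integrable_mul j i).const_mul (N i j)]
  simp only [trace, diag, mul_apply, secondMoment, of_apply]
  refine Finset.sum_congr rfl fun i _ => ?_
  rw [integral_finsetSum _ fun j _ => (μ.integrable_mul j i).const_mul (N i j)]
  exact Finset.sum_congr rfl fun j _ => integral_const_mul _ _

theorem covMatrix_apply_eq (μ : P2 D) (i j : Fin D) :
    covMatrix μ i j = ∫ x, x i * x j ∂μ.toMeasure -
      (∫ x, x i ∂μ.toMeasure) * ∫ x, x j ∂μ.toMeasure :=
  covariance_eq_sub (μ.memLp_apply i) (μ.memLp_apply j)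

theorem covMatrix_gaussian {S : Matrix (Fin D) (Fin D) ℝ} (hS : S.PosSemidef) :
    covMatrix (gaussian S) = S := by
  ext i j
  exact covariance_eval_multivariateGaussian hS i j

theorem integral_apply_gaussian (S : Matrix (Fin D) (Fin D) ℝ) (i : Fin D) :
    ∫ x, x i ∂(gaussian S).toMeasure = 0 := by
  have h := ContinuousLinearMap.integral_comp_comm
    (EuclideanSpace.proj i : EuclideanSpace ℝ (Fin D) →L[ℝ] ℝ)
    (μ := (gaussian S).toMeasure) (φ := fun x => x)
    (IsGaussian.integrable_fun_id (μ := multivariateGaussian 0 S))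
  have h0 : ∫ x, x ∂(gaussian S).toMeasure = 0 := integral_id_multivariateGaussian
  rw [h0] at h
  simpa using h

theorem secondMoment_gaussian {S : Matrix (Fin D) (Fin D) ℝ} (hS : S.PosSemidef) :
    secondMoment (gaussian S) = S := by
  ext i j
  have h := covMatrix_apply_eq (gaussian S) i j
  rw [covMatrix_gaussian hS, integral_apply_gaussian, zero_mul, sub_zero] at h
  exact h.symm

theorem charFun_gaussian {S : Matrix (Fin D) (Fin D) ℝ} (hS : S.PosSemidef)
    (t : EuclideanSpace ℝ (Fin D)) :
    charFun (gaussian S).toMeasure t = Complex.exp (-((t.ofLp ⬝ᵥ S *ᵥ t.ofLp : ℝ) : ℂ) / 2) := by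
  have h := charFun_multivariateGaussian (μ := 0) hS t
  change charFun (multivariateGaussian 0 S) t = _
  rw [h]
  simp [neg_div]

theorem P2.ext_of_charFun {μ ν : P2 D} (h : charFun μ.toMeasure = charFun ν.toMeasure) : μ = ν :=
  Subtype.ext (Measure.ext_of_charFun (μ := μ.toMeasure) (ν := ν.toMeasure) h)

theorem map_gaussian {S : Matrix (Fin D) (Fin D) ℝ} (hS : S.PosSemidef)
    (L : Matrix (Fin D) (Fin D) ℝ) :
    (gaussian S).toMeasure.map (toEuclideanCLM (n := Fin D) (𝕜 := ℝ) L) =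
      (gaussian (L * S * Lᵀ)).toMeasure := by
  have hL : (L * S * Lᵀ).PosSemidef := by
    have := hS.mul_mul_conjTranspose_same L
    rwa [conjTranspose_eq_transpose_of_trivial] at this
  have : IsProbabilityMeasure
      ((gaussian S).toMeasure.map (toEuclideanCLM (n := Fin D) (𝕜 := ℝ) L)) :=
    Measure.isProbabilityMeasure_map (by fun_prop)
  apply Measure.ext_of_charFun
  ext t
  rw [charFun_gaussian hL, charFun_apply, integral_map (by fun_prop) (by fun_prop)]
  have hin : ∀ x : EuclideanSpace ℝ (Fin D),
      inner ℝ (toEuclideanCLM (n := Fin D) (𝕜 := ℝ) L x) t =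
      inner ℝ x (toEuclideanCLM (n := Fin D) (𝕜 := ℝ) Lᵀ t) := fun x => by
    simp only [EuclideanSpace.inner_eq_star_dotProduct, ofLp_toEuclideanCLM, star_trivial]
    rw [dotProduct_mulVec, mulVec_transpose]
  simp only [hin]
  rw [← charFun_apply, charFun_gaussian hS]
  congr 4
  simp only [ofLp_toEuclideanCLM, ← mulVec_mulVec]
  rw [mulVec_transpose, ← dotProduct_mulVec]

section Coupling

variable {μ ν : P2 D}
  {π : Measure (EuclideanSpace ℝ (Fin D) × EuclideanSpace ℝ (Fin D))}

theorem isProbabilityMeasure_of_mem_couplings (hπ : π ∈ couplings μ ν) :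
    IsProbabilityMeasure π := by
  have h : π.fst Set.univ = 1 := by rw [hπ.1]; exact measure_univ
  rw [Measure.fst_univ] at h
  exact ⟨h⟩

theorem measurePreserving_fst_of_mem_couplings (hπ : π ∈ couplings μ ν) :
    MeasurePreserving Prod.fst π μ.toMeasure := ⟨measurable_fst, hπ.1⟩

theorem measurePreserving_snd_of_mem_couplings (hπ : π ∈ couplings μ ν) :
    MeasurePreserving Prod.snd π ν.toMeasure := ⟨measurable_snd, hπ.2⟩

theorem memLp_fst_of_mem_couplings (hπ : π ∈ couplings μ ν) : MemLp Prod.fst 2 π :=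
  μ.memLp.comp_measurePreserving (measurePreserving_fst_of_mem_couplings hπ)

theorem memLp_snd_of_mem_couplings (hπ : π ∈ couplings μ ν) : MemLp Prod.snd 2 π :=
  ν.memLp.comp_measurePreserving (measurePreserving_snd_of_mem_couplings hπ)

theorem memLp_sub_of_mem_couplings (hπ : π ∈ couplings μ ν) :
    MemLp (fun p : EuclideanSpace ℝ (Fin D) × EuclideanSpace ℝ (Fin D) => p.1 - p.2) 2 π :=
  (memLp_fst_of_mem_couplings hπ).sub (memLp_snd_of_mem_couplings hπ)

theorem integrable_norm_sub_sq (hπ : π ∈ couplings μ ν) :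
    Integrable (fun p : EuclideanSpace ℝ (Fin D) × EuclideanSpace ℝ (Fin D) =>
      ‖p.1 - p.2‖ ^ 2) π :=
  (memLp_sub_of_mem_couplings hπ).integrable_norm_pow two_ne_zero

theorem edist_sq_eq_ofReal {E : Type*} [SeminormedAddCommGroup E] (x y : E) :
    edist x y ^ 2 = ENNReal.ofReal (‖x - y‖ ^ 2) := by
  rw [edist_eq_enorm_sub, ← ofReal_norm, ENNReal.ofReal_pow (norm_nonneg _)]

theorem lintegral_edist_sq (hπ : π ∈ couplings μ ν) :
    ∫⁻ p, edist p.1 p.2 ^ 2 ∂π = ENNReal.ofReal (∫ p, ‖p.1 - p.2‖ ^ 2 ∂π) := by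
  simp only [edist_sq_eq_ofReal]
  rw [ofReal_integral_eq_lintegral_ofReal (integrable_norm_sub_sq hπ)
    (.of_forall fun p => by positivity)]

theorem W2sq_le_of_mem_couplings (hπ : π ∈ couplings μ ν) :
    W2sq μ ν ≤ ENNReal.ofReal (∫ p, ‖p.1 - p.2‖ ^ 2 ∂π) := by
  rw [← lintegral_edist_sq hπ]
  exact iInf₂_le π hπ

theorem toReal_W2sq_le_of_mem_couplings (hπ : π ∈ couplings μ ν) :
    (W2sq μ ν).toReal ≤ ∫ p, ‖p.1 - p.2‖ ^ 2 ∂π :=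
  ENNReal.toReal_le_of_le_ofReal (integral_nonneg fun p => by positivity)
    (W2sq_le_of_mem_couplings hπ)

end Coupling

theorem prod_mem_couplings (μ ν : P2 D) : μ.toMeasure.prod ν.toMeasure ∈ couplings μ ν := by
  constructor <;> simp

theorem W2sq_ne_top (μ ν : P2 D) : W2sq μ ν ≠ ∞ :=
  ne_top_of_le_ne_top ENNReal.ofReal_ne_top (W2sq_le_of_mem_couplings (prod_mem_couplings μ ν))

theorem le_W2sq {μ ν : P2 D} {c : ℝ}
    (h : ∀ π ∈ couplings μ ν, c ≤ ∫ p, ‖p.1 - p.2‖ ^ 2 ∂π) :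
    ENNReal.ofReal c ≤ W2sq μ ν := by
  refine le_iInf₂ fun π hπ => ?_
  rw [lintegral_edist_sq hπ]
  exact ENNReal.ofReal_le_ofReal (h π hπ)

theorem W2sq_comm (μ ν : P2 D) : W2sq μ ν = W2sq ν μ := by
  have key : ∀ μ ν : P2 D, W2sq μ ν ≤ W2sq ν μ := fun μ ν => by
    refine le_iInf₂ fun π hπ => ?_
    have hs : π.map Prod.swap ∈ couplings μ ν := by
      refine ⟨?_, ?_⟩
      · rw [Measure.fst_map_swap]; exact hπ.2
      · rw [Measure.snd_map_swap]; exact hπ.1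
    refine (iInf₂_le _ hs).trans (le_of_eq ?_)
    rw [lintegral_map (by fun_prop) measurable_swap]
    simp only [Prod.fst_swap, Prod.snd_swap, edist_comm]
  exact (key μ ν).antisymm (key ν μ)

/-- Both measures are linear images of the Gaussian of covariance `A`; pushing it forward by `x ↦ (S
x, T x)` is a coupling with this cost. -/
theorem W2sq_gaussian_le {A : Matrix (Fin D) (Fin D) ℝ} (hA : A.PosSemidef)
    (S T : Matrix (Fin D) (Fin D) ℝ) :
    W2sq (gaussian (S * A * Sᵀ)) (gaussian (T * A * Tᵀ)) ≤
      ENNReal.ofReal (((S - T) * A * (S - T)ᵀ).trace) := by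
  set f : EuclideanSpace ℝ (Fin D) → EuclideanSpace ℝ (Fin D) × EuclideanSpace ℝ (Fin D) :=
    fun x => (toEuclideanCLM (n := Fin D) (𝕜 := ℝ) S x, toEuclideanCLM (n := Fin D) (𝕜 := ℝ) T x)
    with hf
  have hfm : Measurable f := by fun_prop
  have hπ : (gaussian A).toMeasure.map f ∈
      couplings (gaussian (S * A * Sᵀ)) (gaussian (T * A * Tᵀ)) := by
    constructor
    · rw [hf, Measure.fst_map_prodMk (by fun_prop)]; exact map_gaussian hA S
    · rw [hf, Measure.snd_map_prodMk (by fun_prop)]; exact map_gaussian hA T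
  refine (W2sq_le_of_mem_couplings hπ).trans (le_of_eq ?_)
  rw [integral_map hfm.aemeasurable (by fun_prop)]
  have h1 : ∀ x : EuclideanSpace ℝ (Fin D), ‖(f x).1 - (f x).2‖ ^ 2 =
      x.ofLp ⬝ᵥ ((S - T)ᵀ * (S - T)) *ᵥ x.ofLp := fun x => by
    rw [hf, ← real_inner_self_eq_norm_sq, EuclideanSpace.inner_eq_star_dotProduct]
    simp only [WithLp.ofLp_sub, ofLp_toEuclideanCLM, star_trivial, ← sub_mulVec]
    rw [dotProduct_mulVec, ← mulVec_transpose, mulVec_mulVec, dotProduct_comm]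
  simp only [h1]
  rw [P2.integral_quadratic, secondMoment_gaussian hA, mul_assoc, Matrix.trace_mul_comm]

/-- The dual lower bound for the transport cost to a Gaussian, with the quantitative deficit
that measures the distance of the source to the Gaussian of covariance `A`. -/
theorem dual_le_W2sq {A B T : Matrix (Fin D) (Fin D) ℝ} {c : ℝ} (hc : 0 ≤ c)
    (hB : B.PosDef) (hT : T.PosDef) (hTAT : T * A * T = B)
    (hTc : (T - c • (1 : Matrix (Fin D) (Fin D) ℝ)).PosSemidef) (b : P2 D) :
    ENNReal.ofReal (((1 - T) * secondMoment b).trace + B.trace - (T * A).trace +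
      c * (W2sq b (gaussian A)).toReal) ≤ W2sq b (gaussian B) := by
  have hdet : IsUnit T.det := hT.det_pos.ne'.isUnit
  have hTt := transpose_eq_of_posDef hT
  have hTinvt := transpose_eq_of_posDef hT.inv
  have hTB : T⁻¹ * B * T⁻¹ = A := by
    rw [← hTAT]
    calc T⁻¹ * (T * A * T) * T⁻¹ = (T⁻¹ * T) * A * (T * T⁻¹) := by simp only [mul_assoc]
      _ = A := by rw [nonsing_inv_mul _ hdet, mul_nonsing_inv _ hdet, one_mul, mul_one]
  refine le_W2sq fun π hπ => ?_
  set L := toEuclideanCLM (n := Fin D) (𝕜 := ℝ) T⁻¹ with hL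
  -- Pulling the second marginal back by `T⁻¹` turns a coupling with the Gaussian of `B` into one
  -- with the Gaussian of `A`, whose cost dominates `W2sq b (gaussian A)`.
  have hπ' : π.map (fun p => (p.1, L p.2)) ∈ couplings b (gaussian A) := by
    constructor
    · rw [Measure.fst_map_prodMk (by fun_prop)]; exact hπ.1
    · rw [Measure.snd_map_prodMk (by fun_prop)]
      have : π.map (fun p => L p.2) = (π.map Prod.snd).map L :=
        (Measure.map_map (by fun_prop) measurable_snd).symm
      rw [this]
      have h2 : π.map Prod.snd = (gaussian B).toMeasure := hπ.2
      have h3 := map_gaussian hB.posSemidef T⁻¹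
      rw [hTinvt, hTB] at h3
      rw [h2, ← h3]
  -- The difference between the cost and the two potentials is exactly `(x - T⁻¹ y) ⬝ᵥ T (x - T⁻¹
  -- y)`, and `T ≥ c`.
  have hpt : ∀ p : EuclideanSpace ℝ (Fin D) × EuclideanSpace ℝ (Fin D),
      p.1.ofLp ⬝ᵥ (1 - T) *ᵥ p.1.ofLp + p.2.ofLp ⬝ᵥ (1 - T⁻¹) *ᵥ p.2.ofLp +
        c * ‖p.1 - L p.2‖ ^ 2 ≤ ‖p.1 - p.2‖ ^ 2 := by
    rintro ⟨p, q⟩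
    rw [← real_inner_self_eq_norm_sq, ← real_inner_self_eq_norm_sq,
      EuclideanSpace.inner_eq_star_dotProduct, EuclideanSpace.inner_eq_star_dotProduct]
    simp only [WithLp.ofLp_sub, hL, ofLp_toEuclideanCLM, star_trivial]
    generalize p.ofLp = x
    generalize q.ofLp = y
    have h1 := (posSemidef_iff_real.1 hTc).2 (x - T⁻¹ *ᵥ y)
    have e1 : T *ᵥ (T⁻¹ *ᵥ y) = y := by rw [mulVec_mulVec, mul_nonsing_inv _ hdet, one_mulVec]
    have e2 : (T⁻¹ *ᵥ y) ⬝ᵥ (T *ᵥ x) = x ⬝ᵥ y := by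
      rw [dotProduct_mulVec, ← mulVec_transpose, hTt, e1, dotProduct_comm]
    have e3 : (T⁻¹ *ᵥ y) ⬝ᵥ y = y ⬝ᵥ (T⁻¹ *ᵥ y) := dotProduct_comm _ _
    have e4 : (T⁻¹ *ᵥ y) ⬝ᵥ x = x ⬝ᵥ (T⁻¹ *ᵥ y) := dotProduct_comm _ _
    have e5 : y ⬝ᵥ x = x ⬝ᵥ y := dotProduct_comm _ _
    simp only [sub_mulVec, mulVec_sub, smul_mulVec, one_mulVec, dotProduct_sub, sub_dotProduct,
      dotProduct_smul, smul_eq_mul, e1, e2, e3, e4, e5] at h1 ⊢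
    linarith
  have hfst := measurePreserving_fst_of_mem_couplings hπ
  have hsnd := measurePreserving_snd_of_mem_couplings hπ
  have i1 : Integrable (fun p : EuclideanSpace ℝ (Fin D) × EuclideanSpace ℝ (Fin D) =>
      p.1.ofLp ⬝ᵥ (1 - T) *ᵥ p.1.ofLp) π :=
    hfst.integrable_comp_of_integrable (b.integrable_quadratic (1 - T))
  have i2 : Integrable (fun p : EuclideanSpace ℝ (Fin D) × EuclideanSpace ℝ (Fin D) =>
      p.2.ofLp ⬝ᵥ (1 - T⁻¹) *ᵥ p.2.ofLp) π :=
    hsnd.integrable_comp_of_integrable ((gaussian B).integrable_quadratic (1 - T⁻¹))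
  have hm : Measurable fun p : EuclideanSpace ℝ (Fin D) × EuclideanSpace ℝ (Fin D) =>
    (p.1, L p.2) := by fun_prop
  have i3 : Integrable (fun p : EuclideanSpace ℝ (Fin D) × EuclideanSpace ℝ (Fin D) =>
      ‖p.1 - L p.2‖ ^ 2) π :=
    (integrable_norm_sub_sq hπ').comp_measurable hm
  have v1 : ∫ p, p.1.ofLp ⬝ᵥ (1 - T) *ᵥ p.1.ofLp ∂π = ((1 - T) * secondMoment b).trace := by
    rw [← b.integral_quadratic, ← hfst.map_eq, integral_map (by fun_prop) ?_]
    rw [hfst.map_eq]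
    exact (b.integrable_quadratic _).1
  have v2 : ∫ p, p.2.ofLp ⬝ᵥ (1 - T⁻¹) *ᵥ p.2.ofLp ∂π = B.trace - (T * A).trace := by
    have : ((1 - T⁻¹) * B).trace = B.trace - (T * A).trace := by
      rw [sub_mul, one_mul, trace_sub, ← hTAT, mul_assoc, ← mul_assoc T⁻¹,
        nonsing_inv_mul _ hdet, one_mul, Matrix.trace_mul_comm A]
    have hq := (gaussian B).integral_quadratic (1 - T⁻¹)
    rw [secondMoment_gaussian hB.posSemidef] at hq
    rw [← this, ← hq, ← hsnd.map_eq, integral_map (by fun_prop) ?_]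
    rw [hsnd.map_eq]
    exact ((gaussian B).integrable_quadratic _).1
  have v3 : (W2sq b (gaussian A)).toReal ≤ ∫ p, ‖p.1 - L p.2‖ ^ 2 ∂π := by
    refine (toReal_W2sq_le_of_mem_couplings hπ').trans (le_of_eq ?_)
    rw [integral_map hm.aemeasurable (by fun_prop)]
  have hint := integral_mono ((i1.add i2).add (i3.const_mul c)) (integrable_norm_sub_sq hπ) hpt
  rw [integral_add' (i1.add i2) (i3.const_mul c), integral_add' i1 i2, integral_const_mul, v1, v2]
    at hint
  have := mul_le_mul_of_nonneg_left v3 hc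
  linarith

/-- The linear map given by `transportMatrix A B` supplies the upper bound; duality with zero
deficit constant supplies the matching lower bound. -/
theorem W2sq_gaussian_gaussian {A B : Matrix (Fin D) (Fin D) ℝ} (hA : A.PosDef) (hB : B.PosDef) :
    W2sq (gaussian A) (gaussian B) = ENNReal.ofReal (buresSq A B) := by
  have hT := posDef_transportMatrix hA hB
  have hTAT := transportMatrix_mul_mul hA hB
  apply le_antisymm
  · have h := W2sq_gaussian_le hA.posSemidef 1 (transportMatrix A B)
    simp only [transpose_sub, transpose_one, transpose_eq_of_posDef hT, one_mul, mul_one, hTAT] at h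
    rwa [buresSq_eq_trace hA hB]
  · have h := dual_le_W2sq le_rfl hB hT hTAT (by simpa using hT.posSemidef) (gaussian A)
    rw [secondMoment_gaussian hA.posSemidef, sub_mul, one_mul, trace_sub, zero_mul, add_zero] at h
    rw [buresSq_eq hA]
    refine (le_of_eq ?_).trans h
    congr 1
    ring

theorem buresSq_nonneg {A B : Matrix (Fin D) (Fin D) ℝ} (hA : A.PosDef) (hB : B.PosDef) :
    0 ≤ buresSq A B := by
  rw [buresSq_eq_trace hA hB]
  refine (posSemidef_conj hA.posSemidef ?_).trace_nonneg
  rw [transpose_sub, transpose_one, transpose_eq_of_posDef (posDef_transportMatrix hA hB)]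

end Wasserstein

/-! ### Continuity in the Wasserstein topology and closedness of the regular Gaussians -/

section Topology

variable {D : ℕ}

/-- Integrals of functions of at most quadratic growth depend continuously on the measure. -/
theorem exists_abs_integral_sub_lt {f : EuclideanSpace ℝ (Fin D) → ℝ} {C : ℝ} (hC : 0 < C)
    (hf : ∀ x y, |f x - f y| ≤ C * (‖x - y‖ * (1 + ‖x‖ + ‖y‖)))
    (hint : ∀ μ : P2 D, Integrable f μ.toMeasure) (μ : P2 D) {ε : ℝ} (hε : 0 < ε) :
    ∃ r : NNReal, 0 < r ∧ ∀ ν, W2sq μ ν < (r : ℝ≥0∞) ^ 2 →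
      |∫ x, f x ∂μ.toMeasure - ∫ x, f x ∂ν.toMeasure| < ε := by
  have hmint : Integrable (fun x => (1 + 2 * ‖x‖) ^ 2) μ.toMeasure := by
    have h1 : MemLp (fun x : EuclideanSpace ℝ (Fin D) => ‖x‖) 2 μ.toMeasure := μ.memLp.norm
    have h2 : MemLp (fun _ : EuclideanSpace ℝ (Fin D) => (1 : ℝ)) 2 μ.toMeasure := memLp_const 1
    have h3 : MemLp (fun x : EuclideanSpace ℝ (Fin D) => 2 * ‖x‖) 2 μ.toMeasure := h1.const_mul 2
    exact (h2.add h3).integrable_sq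
  set m := ∫ x, (1 + 2 * ‖x‖) ^ 2 ∂μ.toMeasure with hm
  have hm0 : 0 ≤ m := integral_nonneg fun x => by positivity
  -- `δ` is the Young weight that keeps the moment term below `ε / 2`; `m + 1` avoids dividing by
  -- zero. The radius `√(ε / (2 * K))` then keeps the transport cost term within `ε / 2`.
  set δ := ε / (2 * C * (m + 1)) with hδ
  have hδ0 : 0 < δ := by positivity
  set K := C * (1 / δ + 1) with hK
  have hK0 : 0 < K := by positivity
  refine ⟨Real.toNNReal (Real.sqrt (ε / (2 * K))), by positivity, fun ν hν => ?_⟩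
  simp only [W2sq, iInf_lt_iff] at hν
  obtain ⟨π, hπ, hlt⟩ := hν
  have : IsProbabilityMeasure π := isProbabilityMeasure_of_mem_couplings hπ
  rw [lintegral_edist_sq hπ] at hlt
  have hr : ((Real.toNNReal (Real.sqrt (ε / (2 * K))) : NNReal) : ℝ≥0∞) ^ 2 =
      ENNReal.ofReal (ε / (2 * K)) := by
    change (ENNReal.ofReal _) ^ 2 = _
    rw [← ENNReal.ofReal_pow (Real.sqrt_nonneg _), Real.sq_sqrt (by positivity)]
  rw [hr, ENNReal.ofReal_lt_ofReal_iff (by positivity)] at hlt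
  have hfst := measurePreserving_fst_of_mem_couplings hπ
  have hsnd := measurePreserving_snd_of_mem_couplings hπ
  have e1 : ∫ x, f x ∂μ.toMeasure = ∫ p, f p.1 ∂π := by
    rw [← hfst.map_eq, integral_map (by fun_prop) (by rw [hfst.map_eq]; exact (hint μ).1)]
  have e2 : ∫ x, f x ∂ν.toMeasure = ∫ p, f p.2 ∂π := by
    rw [← hsnd.map_eq, integral_map (by fun_prop) (by rw [hsnd.map_eq]; exact (hint ν).1)]
  have e3 : m = ∫ p, (1 + 2 * ‖p.1‖) ^ 2 ∂π := by
    rw [hm, ← hfst.map_eq, integral_map (by fun_prop) (by fun_prop)]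
  have i1 : Integrable (fun p : _ × EuclideanSpace ℝ (Fin D) => f p.1) π :=
    hfst.integrable_comp_of_integrable (hint μ)
  have i2 : Integrable (fun p : EuclideanSpace ℝ (Fin D) × _ => f p.2) π :=
    hsnd.integrable_comp_of_integrable (hint ν)
  have i3 : Integrable (fun p : EuclideanSpace ℝ (Fin D) × EuclideanSpace ℝ (Fin D) =>
      (1 + 2 * ‖p.1‖) ^ 2) π := hfst.integrable_comp_of_integrable hmint
  have i4 := integrable_norm_sub_sq hπ
  have hpt : ∀ p : EuclideanSpace ℝ (Fin D) × EuclideanSpace ℝ (Fin D),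
      |f p.1 - f p.2| ≤ C * δ * (1 + 2 * ‖p.1‖) ^ 2 + K * ‖p.1 - p.2‖ ^ 2 := by
    rintro ⟨x, y⟩
    refine (hf x y).trans ?_
    have h1 : ‖y‖ ≤ ‖x‖ + ‖x - y‖ := by
      have := norm_sub_norm_le y x
      rw [norm_sub_rev] at this
      linarith
    have h2 : ‖x - y‖ * (1 + 2 * ‖x‖) ≤ δ * (1 + 2 * ‖x‖) ^ 2 + 1 / δ * ‖x - y‖ ^ 2 := by
      have h3 : 0 ≤ 1 / δ * (δ * (1 + 2 * ‖x‖) - ‖x - y‖) ^ 2 := by positivity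
      have h4 : 1 / δ * (δ * (1 + 2 * ‖x‖) - ‖x - y‖) ^ 2 = δ * (1 + 2 * ‖x‖) ^ 2 -
          2 * (‖x - y‖ * (1 + 2 * ‖x‖)) + 1 / δ * ‖x - y‖ ^ 2 := by field_simp; ring
      have h5 : 0 ≤ ‖x - y‖ * (1 + 2 * ‖x‖) := by positivity
      linarith
    have h6 : ‖x - y‖ * (1 + ‖x‖ + ‖y‖) ≤ ‖x - y‖ * (1 + 2 * ‖x‖) + ‖x - y‖ ^ 2 := by
      nlinarith [norm_nonneg (x - y)]
    have h7 := mul_le_mul_of_nonneg_left (h6.trans (add_le_add_left h2 _)) hC.le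
    rw [hK]
    nlinarith
  rw [e1, e2, ← integral_sub i1 i2]
  refine (abs_integral_le_integral_abs).trans_lt ?_
  refine (integral_mono (i1.sub i2).abs
    ((i3.const_mul (C * δ)).add (i4.const_mul K)) hpt).trans_lt ?_
  rw [integral_add' (i3.const_mul (C * δ)) (i4.const_mul K), integral_const_mul, integral_const_mul,
    ← e3]
  have h1 : C * δ * m < ε / 2 := by
    have : C * δ * (m + 1) = ε / 2 := by rw [hδ]; field_simp
    have : 0 < C * δ := by positivity
    nlinarith
  have h2 : K * ∫ p, ‖p.1 - p.2‖ ^ 2 ∂π ≤ ε / 2 := by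
    have := mul_le_mul_of_nonneg_left hlt.le hK0.le
    have h3 : K * (ε / (2 * K)) = ε / 2 := by field_simp
    linarith
  linarith

theorem continuous_integral_P2 {f : EuclideanSpace ℝ (Fin D) → ℝ} {C : ℝ} (hC : 0 < C)
    (hf : ∀ x y, |f x - f y| ≤ C * (‖x - y‖ * (1 + ‖x‖ + ‖y‖)))
    (hint : ∀ μ : P2 D, Integrable f μ.toMeasure) :
    Continuous fun μ : P2 D => ∫ x, f x ∂μ.toMeasure := by
  refine continuous_def.2 fun U hU μ hμ => ?_
  obtain ⟨ε, hε, hball⟩ := Metric.isOpen_iff.1 hU _ hμ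
  obtain ⟨r, hr, h⟩ := exists_abs_integral_sub_lt hC hf hint μ hε
  refine ⟨r, by simpa using hr, fun ν hν => hball ?_⟩
  rw [Metric.mem_ball, dist_comm, Real.dist_eq]
  exact h ν hν

theorem integral_eq_of_W2sq_eq_zero {f : EuclideanSpace ℝ (Fin D) → ℝ} {C : ℝ} (hC : 0 < C)
    (hf : ∀ x y, |f x - f y| ≤ C * (‖x - y‖ * (1 + ‖x‖ + ‖y‖)))
    (hint : ∀ μ : P2 D, Integrable f μ.toMeasure) {μ ν : P2 D} (h : W2sq μ ν = 0) :
    ∫ x, f x ∂μ.toMeasure = ∫ x, f x ∂ν.toMeasure := by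
  by_contra hne
  obtain ⟨r, hr, hlt⟩ := exists_abs_integral_sub_lt hC hf hint μ (abs_pos.2 (sub_ne_zero.2 hne))
  exact lt_irrefl _ (hlt ν (by rw [h]; positivity))

theorem abs_inner_sub_inner_le {E : Type*} [NormedAddCommGroup E] [InnerProductSpace ℝ E]
    (t x y : E) : |inner ℝ x t - inner ℝ y t| ≤ (‖t‖ + 1) * (‖x - y‖ * (1 + ‖x‖ + ‖y‖)) := by
  rw [← inner_sub_left]
  have h1 := abs_real_inner_le_norm (x - y) t
  have h2 : ‖x - y‖ * ‖t‖ ≤ (‖t‖ + 1) * ‖x - y‖ := by nlinarith [norm_nonneg (x - y)]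
  have h3 : ‖x - y‖ ≤ ‖x - y‖ * (1 + ‖x‖ + ‖y‖) := by
    nlinarith [norm_nonneg (x - y), norm_nonneg x, norm_nonneg y,
      mul_nonneg (norm_nonneg (x - y)) (norm_nonneg x),
      mul_nonneg (norm_nonneg (x - y)) (norm_nonneg y)]
  exact h1.trans (h2.trans (mul_le_mul_of_nonneg_left h3 (by positivity)))

theorem abs_cos_inner_sub_le (t x y : EuclideanSpace ℝ (Fin D)) :
    |Real.cos (inner ℝ x t) - Real.cos (inner ℝ y t)| ≤
      (‖t‖ + 1) * (‖x - y‖ * (1 + ‖x‖ + ‖y‖)) :=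
  (Real.abs_cos_sub_cos_le _ _).trans (abs_inner_sub_inner_le t x y)

theorem abs_sin_inner_sub_le (t x y : EuclideanSpace ℝ (Fin D)) :
    |Real.sin (inner ℝ x t) - Real.sin (inner ℝ y t)| ≤
      (‖t‖ + 1) * (‖x - y‖ * (1 + ‖x‖ + ‖y‖)) :=
  (Real.abs_sin_sub_sin_le _ _).trans (abs_inner_sub_inner_le t x y)

theorem integrable_cos_inner (t : EuclideanSpace ℝ (Fin D)) (μ : P2 D) :
    Integrable (fun x => Real.cos (inner ℝ x t)) μ.toMeasure :=
  Integrable.of_bound (by fun_prop) 1 (.of_forall fun x => Real.abs_cos_le_one _)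

theorem integrable_sin_inner (t : EuclideanSpace ℝ (Fin D)) (μ : P2 D) :
    Integrable (fun x => Real.sin (inner ℝ x t)) μ.toMeasure :=
  Integrable.of_bound (by fun_prop) 1 (.of_forall fun x => Real.abs_sin_le_one _)

theorem charFun_eq_cos_add_sin (t : EuclideanSpace ℝ (Fin D)) (μ : P2 D) :
    charFun μ.toMeasure t = ((∫ x, Real.cos (inner ℝ x t) ∂μ.toMeasure : ℝ) : ℂ) +
      ((∫ x, Real.sin (inner ℝ x t) ∂μ.toMeasure : ℝ) : ℂ) * Complex.I := by
  rw [charFun_apply, ← integral_complex_ofReal, ← integral_complex_ofReal, ← integral_mul_const,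
    ← integral_add (integrable_cos_inner t μ).ofReal
      ((integrable_sin_inner t μ).ofReal.mul_const _)]
  refine integral_congr_ae (.of_forall fun x => ?_)
  simp only [Complex.exp_mul_I, Complex.ofReal_cos, Complex.ofReal_sin]

/-- The real and imaginary parts of the characteristic function are integrals of Lipschitz
functions, which measures at distance zero cannot distinguish. -/
theorem eq_of_W2sq_eq_zero {μ ν : P2 D} (h : W2sq μ ν = 0) : μ = ν := by
  refine P2.ext_of_charFun (funext fun t => ?_)
  rw [charFun_eq_cos_add_sin, charFun_eq_cos_add_sin,
    integral_eq_of_W2sq_eq_zero (by positivity) (abs_cos_inner_sub_le t) (integrable_cos_inner t) h,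
    integral_eq_of_W2sq_eq_zero (by positivity) (abs_sin_inner_sub_le t) (integrable_sin_inner t) h]

theorem continuous_charFun (t : EuclideanSpace ℝ (Fin D)) :
    Continuous fun μ : P2 D => charFun μ.toMeasure t := by
  simp only [charFun_eq_cos_add_sin]
  have h1 := continuous_integral_P2 (by positivity) (abs_cos_inner_sub_le t)
    (integrable_cos_inner t)
  have h2 := continuous_integral_P2 (by positivity) (abs_sin_inner_sub_le t)
    (integrable_sin_inner t)
  fun_prop

theorem continuous_covMatrix : Continuous (covMatrix : P2 D → Matrix (Fin D) (Fin D) ℝ) := by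
  have hcoord : ∀ (i : Fin D) (x : EuclideanSpace ℝ (Fin D)), |x i| ≤ ‖x‖ := fun i x =>
    PiLp.norm_apply_le x i
  have h1 : ∀ i, Continuous fun μ : P2 D => ∫ x, x i ∂μ.toMeasure := fun i => by
    refine continuous_integral_P2 one_pos (fun x y => ?_)
      fun μ => (μ.memLp_apply i).integrable one_le_two
    have h := hcoord i (x - y)
    rw [PiLp.sub_apply] at h
    nlinarith [norm_nonneg (x - y), norm_nonneg x, norm_nonneg y,
      mul_nonneg (norm_nonneg (x - y)) (norm_nonneg x),
      mul_nonneg (norm_nonneg (x - y)) (norm_nonneg y)]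
  have h2 : ∀ i j, Continuous fun μ : P2 D => ∫ x, x i * x j ∂μ.toMeasure := fun i j => by
    refine continuous_integral_P2 one_pos (fun x y => ?_) fun μ => μ.integrable_mul i j
    have e : x i * x j - y i * y j = (x - y) i * x j + y i * (x - y) j := by
      simp only [PiLp.sub_apply]; ring
    rw [e]
    refine (abs_add_le _ _).trans ?_
    rw [abs_mul, abs_mul]
    have a1 := mul_le_mul (hcoord i (x - y)) (hcoord j x) (abs_nonneg _) (norm_nonneg _)
    have a2 := mul_le_mul (hcoord i y) (hcoord j (x - y)) (abs_nonneg _) (norm_nonneg _)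
    nlinarith [norm_nonneg (x - y)]
  refine continuous_matrix fun i j => ?_
  simp only [covMatrix_apply_eq]
  exact (h2 i j).sub ((h1 i).mul (h1 j))

/-- Needed to place every point of `Q.support` in this set. Being a centered Gaussian is closed
because it amounts to an identity, for each `t`, between the characteristic function and the
covariance, both continuous in the measure. -/
theorem isClosed_regularGaussians {ζ : ℝ} (hζ : 0 < ζ) : IsClosed (regularGaussians D ζ) := by
  have : regularGaussians D ζ = covMatrix ⁻¹' ({S | S.PosSemidef} ∩
      {S | ‖toEuclideanCLM (n := Fin D) (𝕜 := ℝ) S‖ ≤ 1} ∩ {S | ζ ≤ S.det}) ∩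
      ⋂ t : EuclideanSpace ℝ (Fin D), {μ | charFun μ.toMeasure t =
        Complex.exp (-((t.ofLp ⬝ᵥ covMatrix μ *ᵥ t.ofLp : ℝ) : ℂ) / 2)} := by
    ext μ
    simp only [regularGaussians, Set.mem_ofPred_eq, Set.mem_inter_iff, Set.mem_preimage,
      Set.mem_iInter]
    constructor
    · rintro ⟨S, hS, hn, hd, rfl⟩
      rw [covMatrix_gaussian hS.posSemidef]
      exact ⟨⟨⟨hS.posSemidef, hn⟩, hd⟩, fun t => charFun_gaussian hS.posSemidef t⟩
    · rintro ⟨⟨⟨hS, hn⟩, hd⟩, ht⟩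
      refine ⟨covMatrix μ, hS.posDef_iff_det_ne_zero.2 (hζ.trans_le hd).ne', hn, hd, ?_⟩
      refine P2.ext_of_charFun (funext fun t => ?_)
      rw [ht, charFun_gaussian hS]
  rw [this]
  have hlin : Continuous fun S : Matrix (Fin D) (Fin D) ℝ =>
      toEuclideanCLM (n := Fin D) (𝕜 := ℝ) S :=
    LinearMap.continuous_of_finiteDimensional
      (toEuclideanCLM (n := Fin D) (𝕜 := ℝ)).toAlgEquiv.toLinearMap
  refine IsClosed.inter (IsClosed.preimage continuous_covMatrix ?_) (isClosed_iInter fun t => ?_)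
  · exact (isClosed_posSemidef.inter (isClosed_le hlin.norm continuous_const)).inter
      (isClosed_le continuous_const (by fun_prop))
  · have hq : Continuous fun μ : P2 D => t.ofLp ⬝ᵥ covMatrix μ *ᵥ t.ofLp := by
      have := continuous_covMatrix (D := D)
      fun_prop
    exact isClosed_eq (continuous_charFun t) (by fun_prop)

theorem regular_covMatrix {ζ : ℝ} {μ : P2 D} (hμ : μ ∈ regularGaussians D ζ) :
    Regular ζ (covMatrix μ) ∧ μ = gaussian (covMatrix μ) := by
  obtain ⟨S, hS, hn, hd, rfl⟩ := hμ
  rw [covMatrix_gaussian hS.posSemidef]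
  refine ⟨⟨hS, posSemidef_iff_real.2 ⟨?_, fun x => ?_⟩, hd⟩, rfl⟩
  · rw [transpose_sub, transpose_one, transpose_eq_of_posDef hS]
  · have h1 := (toEuclideanCLM (n := Fin D) (𝕜 := ℝ) S).le_of_opNorm_le hn (WithLp.toLp 2 x)
    have h2 := real_inner_le_norm (toEuclideanCLM (n := Fin D) (𝕜 := ℝ) S (WithLp.toLp 2 x))
      (WithLp.toLp 2 x)
    have h3 := real_inner_self_eq_norm_sq (WithLp.toLp 2 x : EuclideanSpace ℝ (Fin D))
    simp only [EuclideanSpace.inner_eq_star_dotProduct, ofLp_toEuclideanCLM, star_trivial] at h2 h3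
    rw [sub_mulVec, one_mulVec, dotProduct_sub]
    nlinarith [norm_nonneg (WithLp.toLp 2 x : EuclideanSpace ℝ (Fin D))]

end Topology

/-! ### Absolute continuity of nondegenerate Gaussians -/

section AbsolutelyContinuous

theorem pi_gaussianReal_absolutelyContinuous (D : ℕ) :
    Measure.pi (fun _ : Fin D => gaussianReal 0 1) ≪ (volume : Measure (Fin D → ℝ)) := by
  have : Measure.pi (fun _ : Fin D => gaussianReal 0 1) =
      (volume : Measure (Fin D → ℝ)).withDensity
        (fun x => ENNReal.ofReal (∏ i, gaussianPDFReal 0 1 (x i))) := by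
    refine Measure.pi_eq fun s hs => ?_
    have hms : MeasurableSet (Set.univ.pi s) := MeasurableSet.univ_pi hs
    have hint : Integrable (fun x : Fin D → ℝ => ∏ i, gaussianPDFReal 0 1 (x i)) volume :=
      Integrable.fintype_prod (f := fun _ : Fin D => gaussianPDFReal 0 1)
        fun i => integrable_gaussianPDFReal 0 1
    rw [withDensity_apply _ hms, ← ofReal_integral_eq_lintegral_ofReal hint.integrableOn
      (.of_forall fun x => Finset.prod_nonneg fun i _ => gaussianPDFReal_nonneg 0 1 _)]
    simp only [gaussianReal_apply_eq_integral 0 one_ne_zero]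
    rw [← ENNReal.ofReal_prod_of_nonneg fun i _ =>
      integral_nonneg fun x => gaussianPDFReal_nonneg 0 1 x, ← integral_indicator hms]
    congr 1
    have hi : ∀ x : Fin D → ℝ, (Set.univ.pi s).indicator
        (fun x : Fin D → ℝ => ∏ i, gaussianPDFReal 0 1 (x i)) x =
        ∏ i, (s i).indicator (gaussianPDFReal 0 1) (x i) := fun x => by
      by_cases hx : x ∈ Set.univ.pi s
      · rw [Set.indicator_of_mem hx]
        exact Finset.prod_congr rfl fun i _ => (Set.indicator_of_mem (hx i trivial) _).symm
      · rw [Set.indicator_of_notMem hx]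
        simp only [Set.mem_univ_pi, not_forall] at hx
        obtain ⟨i, hi⟩ := hx
        exact (Finset.prod_eq_zero (Finset.mem_univ i) (Set.indicator_of_notMem hi _)).symm
    simp only [hi]
    rw [volume_pi, integral_fintype_prod_eq_prod]
    exact Finset.prod_congr rfl fun i _ => integral_indicator (hs i)
  rw [this]
  exact withDensity_absolutelyContinuous _ _

theorem gaussian_absolutelyContinuous {D : ℕ} {S : Matrix (Fin D) (Fin D) ℝ} (hS : S.PosDef) :
    (gaussian S).toMeasure ≪ volume := by
  have hstd : stdGaussian (EuclideanSpace ℝ (Fin D)) ≪ volume := by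
    rw [← map_pi_eq_stdGaussian, ← (PiLp.volume_preserving_toLp (Fin D)).map_eq]
    exact (pi_gaussianReal_absolutelyContinuous D).map (by fun_prop)
  have hR := posDef_sqrt hS
  have hrw : (gaussian S).toMeasure = (stdGaussian (EuclideanSpace ℝ (Fin D))).map
      (toEuclideanCLM (n := Fin D) (𝕜 := ℝ) (CFC.sqrt S)) := by
    change multivariateGaussian 0 S = _
    simp [multivariateGaussian]
  rw [hrw]
  refine (hstd.map (by fun_prop)).trans ?_
  have hdet : LinearMap.det
      ((toEuclideanCLM (n := Fin D) (𝕜 := ℝ) (CFC.sqrt S)).toLinearMap) ≠ 0 := by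
    intro h0
    have h1 := congr_arg (fun f : EuclideanSpace ℝ (Fin D) →L[ℝ] EuclideanSpace ℝ (Fin D) =>
      LinearMap.det f.toLinearMap) (map_mul (toEuclideanCLM (n := Fin D) (𝕜 := ℝ))
        (CFC.sqrt S) (CFC.sqrt S)⁻¹)
    rw [mul_nonsing_inv _ hR.det_pos.ne'.isUnit, map_one] at h1
    simp only [ContinuousLinearMap.toLinearMap_mul] at h1
    rw [map_mul, h0, zero_mul] at h1
    simp at h1
  have h := Measure.map_linearMap_addHaar_eq_smul_addHaar
    (volume : Measure (EuclideanSpace ℝ (Fin D))) hdet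
  rw [ContinuousLinearMap.coe_coe] at h
  rw [h]
  exact Measure.smul_absolutelyContinuous

end AbsolutelyContinuous

/-! ### Averages over `Q`, descent and the Polyak-Łojasiewicz inequality -/

section Average

variable {D : ℕ} {ζ : ℝ} {Q : Measure (P2 D)} [IsProbabilityMeasure Q]

/-- Almost every covariance lies in a compact set, where `f` is bounded; measurability follows from
continuity on the closed semidefinite cone. -/
theorem integrable_comp_covMatrix (hζ : 0 < ζ) (hreg : ∀ᵐ μ ∂Q, Regular ζ (covMatrix μ))
    {f : Matrix (Fin D) (Fin D) ℝ → ℝ} (hf : ContinuousOn f {S | S.PosSemidef}) :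
    Integrable (fun μ => f (covMatrix μ)) Q := by
  have hsub : {A : Matrix (Fin D) (Fin D) ℝ | Regular ζ A} ⊆ {S | S.PosSemidef} :=
    fun A hA => hA.1.posSemidef
  obtain ⟨C, hC⟩ := (isCompact_regular hζ).exists_bound_of_continuousOn (hf.mono hsub)
  refine Integrable.of_bound ?_ C (hreg.mono fun μ hμ => hC _ hμ)
  have hm : MeasurableSet (covMatrix ⁻¹' {S : Matrix (Fin D) (Fin D) ℝ | S.PosSemidef}) :=
    (isClosed_posSemidef.preimage continuous_covMatrix).measurableSet
  have h := (hf.comp continuous_covMatrix.continuousOn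
    (Set.mapsTo_preimage _ _)).aestronglyMeasurable hm (μ := Q)
  have hmem : ∀ᵐ μ ∂Q, μ ∈ covMatrix ⁻¹' {S : Matrix (Fin D) (Fin D) ℝ | S.PosSemidef} :=
    hreg.mono fun μ hμ => hsub hμ
  rwa [Measure.restrict_eq_self_of_ae_mem hmem] at h

theorem integrable_transportMatrix (hζ : 0 < ζ) (hreg : ∀ᵐ μ ∂Q, Regular ζ (covMatrix μ))
    (A : Matrix (Fin D) (Fin D) ℝ) (i j : Fin D) :
    Integrable (fun μ => transportMatrix A (covMatrix μ) i j) Q :=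
  integrable_comp_covMatrix hζ hreg (f := fun B => transportMatrix A B i j)
    ((continuous_apply_apply i j).comp_continuousOn (continuousOn_transportMatrix A))

theorem integrable_trace_mul_transportMatrix (hζ : 0 < ζ)
    (hreg : ∀ᵐ μ ∂Q, Regular ζ (covMatrix μ)) (A N : Matrix (Fin D) (Fin D) ℝ) :
    Integrable (fun μ => (N * transportMatrix A (covMatrix μ)).trace) Q := by
  simp only [trace, diag, mul_apply]
  exact integrable_finsetSum _ fun i _ => integrable_finsetSum _ fun j _ =>
    (integrable_transportMatrix hζ hreg A j i).const_mul _

theorem integral_trace_mul_transportMatrix (hζ : 0 < ζ)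
    (hreg : ∀ᵐ μ ∂Q, Regular ζ (covMatrix μ)) (A N : Matrix (Fin D) (Fin D) ℝ) :
    ∫ μ, (N * transportMatrix A (covMatrix μ)).trace ∂Q = (N * meanTransport Q A).trace := by
  have h : ∀ i j, Integrable (fun μ => N i j * transportMatrix A (covMatrix μ) j i) Q :=
    fun i j => (integrable_transportMatrix hζ hreg A j i).const_mul _
  simp only [trace, diag, mul_apply, meanTransport, of_apply]
  refine (integral_finsetSum _ fun i _ => integrable_finsetSum _ fun j _ => h i j).trans ?_
  refine Finset.sum_congr rfl fun i _ => ?_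
  refine (integral_finsetSum _ fun j _ => h i j).trans ?_
  exact Finset.sum_congr rfl fun j _ => integral_const_mul _ _

/-- Writes a quadratic form as a trace, so that `integral_trace_mul_transportMatrix` applies to it.
-/
theorem trace_vecMulVec_mul {n : Type*} [Fintype n] (x : n → ℝ) (M : Matrix n n ℝ) :
    (vecMulVec x x * M).trace = x ⬝ᵥ M *ᵥ x := by
  rw [vecMulVec_mul, trace_vecMulVec, dotProduct_comm, dotProduct_mulVec, dotProduct_comm,
    dotProduct_comm]

omit [IsProbabilityMeasure Q] in
theorem transpose_meanTransport (hreg : ∀ᵐ μ ∂Q, Regular ζ (covMatrix μ))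
    {A : Matrix (Fin D) (Fin D) ℝ} (hA : A.PosDef) :
    (meanTransport Q A)ᵀ = meanTransport Q A := by
  ext i j
  refine integral_congr_ae (hreg.mono fun μ hμ => ?_)
  exact congr_fun (congr_fun (transpose_eq_of_posDef (posDef_transportMatrix hA hμ.1)) i) j

theorem posDef_meanTransport (hζ : 0 < ζ) (hζ₁ : ζ ≤ 1)
    (hreg : ∀ᵐ μ ∂Q, Regular ζ (covMatrix μ)) {A : Matrix (Fin D) (Fin D) ℝ}
    (hA : Regular ζ A) : (meanTransport Q A).PosDef := by
  refine posDef_iff_real.2 ⟨transpose_meanTransport hreg hA.1, fun x hx => ?_⟩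
  rw [← trace_vecMulVec_mul, ← integral_trace_mul_transportMatrix hζ hreg]
  have hxx : 0 < x ⬝ᵥ x := by
    have := dotProduct_star_self_pos_iff.2 hx
    simpa using this
  have h : ∀ᵐ μ ∂Q, ζ * (x ⬝ᵥ x) ≤
      (vecMulVec x x * transportMatrix A (covMatrix μ)).trace := hreg.mono fun μ hμ => by
    have := (posSemidef_iff_real.1 (hA.transportMatrix_sub_posSemidef hζ.le hζ₁ hμ)).2 x
    rw [sub_mulVec, smul_mulVec, one_mulVec, dotProduct_sub, dotProduct_smul, smul_eq_mul] at this
    rw [trace_vecMulVec_mul]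
    linarith
  have h1 := integral_mono_ae (integrable_const _)
    (integrable_trace_mul_transportMatrix hζ hreg A (vecMulVec x x)) h
  rw [integral_const, probReal_univ, one_smul] at h1
  exact (mul_pos hζ hxx).trans_le h1

theorem regular_step (hζ : 0 < ζ) (hζ₁ : ζ ≤ 1) (hreg : ∀ᵐ μ ∂Q, Regular ζ (covMatrix μ))
    {A : Matrix (Fin D) (Fin D) ℝ} (hA : Regular ζ A) :
    Regular ζ (meanTransport Q A * A * meanTransport Q A) := by
  have hS := posDef_meanTransport hζ hζ₁ hreg hA
  have hmean := integral_trace_mul_transportMatrix hζ hreg A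
  have hint := integrable_trace_mul_transportMatrix hζ hreg A
  set S := meanTransport Q A with hSdef
  have hSt := transpose_eq_of_posDef hS
  have hSAS := posDef_conj hA.1 hS
  refine ⟨hSAS, posSemidef_iff_real.2 ⟨?_, fun x => ?_⟩, ?_⟩
  · rw [transpose_sub, transpose_one, transpose_eq_of_posDef hSAS]
  · set V := vecMulVec x x
    -- Expand `(T - S) * A * (T - S) ≥ 0` and use `T * A * T ≤ 1`. The bound is affine in `T`, so
    -- averaging replaces `T` by `S` and leaves `S * A * S ≤ 1`.
    have hpt : ∀ᵐ μ ∂Q, 2 * (V * S * A * transportMatrix A (covMatrix μ)).trace -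
        x ⬝ᵥ (S * A * S) *ᵥ x ≤ x ⬝ᵥ x := hreg.mono fun μ hμ => by
      have hT := posDef_transportMatrix hA.1 hμ.1
      have hTt := transpose_eq_of_posDef hT
      have hTAT := transportMatrix_mul_mul hA.1 hμ.1
      set T := transportMatrix A (covMatrix μ)
      have h1 := (posSemidef_iff_real.1 hμ.2.1).2 x
      have h2 := (posSemidef_iff_real.1 (posSemidef_conj hA.1.posSemidef
        (B := T - S) (by rw [transpose_sub, hTt, hSt]))).2 x
      have h3 : (V * S * A * T).trace = x ⬝ᵥ (S * A * T) *ᵥ x := by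
        rw [mul_assoc, mul_assoc, trace_vecMulVec_mul, mul_assoc]
      have h4 : x ⬝ᵥ (T * A * S) *ᵥ x = x ⬝ᵥ (S * A * T) *ᵥ x := by
        have : (T * A * S)ᵀ = S * A * T := by
          rw [transpose_mul, transpose_mul, hTt, hSt, transpose_eq_of_posDef hA.1, mul_assoc]
        rw [← this, mulVec_transpose, dotProduct_mulVec, dotProduct_comm]
      rw [h3]
      simp only [sub_mul, mul_sub, sub_mulVec, dotProduct_sub, one_mulVec, hTAT] at h1 h2
      linarith
    have h := integral_mono_ae (((hint (V * S * A)).const_mul 2).sub (integrable_const _))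
      (integrable_const _) hpt
    simp only [Pi.sub_apply] at h
    rw [integral_sub ((hint (V * S * A)).const_mul 2) (integrable_const _), integral_const_mul,
      hmean, integral_const, integral_const, probReal_univ, one_smul, one_smul] at h
    have h3 : (V * S * A * S).trace = x ⬝ᵥ (S * A * S) *ᵥ x := by
      rw [mul_assoc, mul_assoc, trace_vecMulVec_mul, mul_assoc]
    rw [h3] at h
    rw [sub_mulVec, one_mulVec, dotProduct_sub]
    linarith
  -- Jensen for `log det` through its tangent at `S`, using `2 log det T + log det A ≥ log ζ`. On
  -- averaging, the trace becomes `tr(S⁻¹ S) = D` and cancels the constant.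
  · have hpt : ∀ᵐ μ ∂Q, (Real.log ζ - Real.log A.det) / 2 - Real.log S.det + D ≤
        (S⁻¹ * transportMatrix A (covMatrix μ)).trace := hreg.mono fun μ hμ => by
      have hT := posDef_transportMatrix hA.1 hμ.1
      have hTAT := transportMatrix_mul_mul hA.1 hμ.1
      set T := transportMatrix A (covMatrix μ)
      have h1 := log_det_sub_log_det_le hS hT
      have h2 : Real.log ζ ≤ 2 * Real.log T.det + Real.log A.det := by
        have h3 := Real.log_le_log hζ hμ.2.2
        rw [← hTAT, det_mul, det_mul, Real.log_mul
          (mul_pos hT.det_pos hA.1.det_pos).ne' hT.det_pos.ne',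
          Real.log_mul hT.det_pos.ne' hA.1.det_pos.ne'] at h3
        linarith
      rw [Fintype.card_fin] at h1
      linarith
    have h := integral_mono_ae (integrable_const _) (hint S⁻¹) hpt
    rw [hmean, integral_const, probReal_univ, one_smul,
      nonsing_inv_mul _ hS.det_pos.ne'.isUnit, trace_one, Fintype.card_fin] at h
    rw [← Real.log_le_log_iff hζ hSAS.det_pos, det_mul, det_mul, Real.log_mul
          (mul_pos hS.det_pos hA.1.det_pos).ne' hS.det_pos.ne',
          Real.log_mul hS.det_pos.ne' hA.1.det_pos.ne']
    linarith

/-- The average squared Bures-Wasserstein distance from the covariance matrix `A`. -/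
noncomputable def meanBuresSq (Q : Measure (P2 D)) (A : Matrix (Fin D) (Fin D) ℝ) : ℝ :=
  ∫ μ, buresSq A (covMatrix μ) ∂Q

theorem integrable_buresSq (hζ : 0 < ζ) (hreg : ∀ᵐ μ ∂Q, Regular ζ (covMatrix μ))
    {A : Matrix (Fin D) (Fin D) ℝ} (hA : A.PosDef) :
    Integrable (fun μ => buresSq A (covMatrix μ)) Q :=
  integrable_comp_covMatrix hζ hreg (f := fun B => buresSq A B)
    (continuousOn_buresSq.comp (f := fun B => (A, B)) (by fun_prop)
      fun B hB => ⟨hA.posSemidef, hB⟩)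

omit [IsProbabilityMeasure Q] in
theorem meanBuresSq_nonneg (hreg : ∀ᵐ μ ∂Q, Regular ζ (covMatrix μ))
    {A : Matrix (Fin D) (Fin D) ℝ} (hA : A.PosDef) : 0 ≤ meanBuresSq Q A :=
  integral_nonneg_of_ae (hreg.mono fun _ hμ => buresSq_nonneg hA hμ.1)

theorem continuousOn_meanBuresSq (hζ : 0 < ζ) (hreg : ∀ᵐ μ ∂Q, Regular ζ (covMatrix μ)) :
    ContinuousOn (meanBuresSq Q) {A | Regular ζ A} := by
  have hsub : {A : Matrix (Fin D) (Fin D) ℝ | Regular ζ A} ⊆ {S | S.PosSemidef} :=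
    fun A hA => hA.1.posSemidef
  have hc := (continuousOn_buresSq (D := D)).mono (Set.prod_mono hsub hsub)
  obtain ⟨C, hC⟩ := ((isCompact_regular hζ).prod
    (isCompact_regular hζ)).exists_bound_of_continuousOn hc
  have : FirstCountableTopology (Matrix (Fin D) (Fin D) ℝ) :=
    inferInstanceAs (FirstCountableTopology (Fin D → Fin D → ℝ))
  refine continuousOn_of_dominated (bound := fun _ => C)
    (fun A hA => (integrable_buresSq hζ hreg hA.1).1)
    (fun A hA => hreg.mono fun μ hμ => hC (A, covMatrix μ) ⟨hA, hμ⟩) (integrable_const C)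
    (hreg.mono fun μ hμ => ?_)
  exact hc.comp (f := fun A => (A, covMatrix μ)) (by fun_prop) fun A hA => ⟨hA, hμ⟩

/-- One step of gradient descent decreases the objective. -/
theorem meanBuresSq_step_le (hζ : 0 < ζ) (hζ₁ : ζ ≤ 1)
    (hreg : ∀ᵐ μ ∂Q, Regular ζ (covMatrix μ)) {A : Matrix (Fin D) (Fin D) ℝ}
    (hA : Regular ζ A) :
    meanBuresSq Q (meanTransport Q A * A * meanTransport Q A) ≤ meanBuresSq Q A -
      ((1 - meanTransport Q A) * A * (1 - meanTransport Q A)).trace := by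
  have hstep := regular_step hζ hζ₁ hreg hA
  have hSt := transpose_meanTransport hreg hA.1
  have hmean := integral_trace_mul_transportMatrix hζ hreg A
  have hint := integrable_trace_mul_transportMatrix hζ hreg A
  have hi1 := integrable_buresSq hζ hreg hstep.1
  have hi2 := integrable_buresSq hζ hreg hA.1
  unfold meanBuresSq
  set S := meanTransport Q A with hSdef
  set g := ((1 - S) * A * (1 - S)).trace with hg
  -- `N` is the coefficient of `T` in `tr((S - T) A (S - T))`, expanded via `S - T = (1 - T) - (1 -
  -- S)`. Averaging cancels `tr(N T)` against `tr(N S)` and leaves `-g`.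
  set N := 2 • ((1 - S) * A) with hN
  have hpt : ∀ᵐ μ ∂Q, buresSq (S * A * S) (covMatrix μ) ≤ buresSq A (covMatrix μ) +
      (N * transportMatrix A (covMatrix μ)).trace - ((N * S).trace + g) := hreg.mono fun μ hμ => by
    have hT := posDef_transportMatrix hA.1 hμ.1
    have hTt := transpose_eq_of_posDef hT
    have hTAT := transportMatrix_mul_mul hA.1 hμ.1
    have hb := buresSq_eq_trace hA.1 hμ.1
    have h := W2sq_gaussian_le hA.1.posSemidef S (transportMatrix A (covMatrix μ))
    set T := transportMatrix A (covMatrix μ)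
    have hSTt : (S - T)ᵀ = S - T := by rw [transpose_sub, hTt, hSt]
    rw [hSTt, hSt, hTt, hTAT, W2sq_gaussian_gaussian hstep.1 hμ.1,
      ENNReal.ofReal_le_ofReal_iff (posSemidef_conj hA.1.posSemidef hSTt).trace_nonneg] at h
    refine h.trans (le_of_eq ?_)
    rw [hb, hN, hg]
    have c1 : (T * (A * S)).trace = (S * (A * T)).trace := by
      rw [← trace_transpose (T * (A * S)), transpose_mul, transpose_mul, hTt, hSt,
        transpose_eq_of_posDef hA.1, mul_assoc]
    have c2 : (A * S).trace = (S * A).trace := Matrix.trace_mul_comm _ _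
    have c3 : (A * T).trace = (T * A).trace := Matrix.trace_mul_comm _ _
    simp only [two_smul, sub_mul, mul_sub, add_mul, one_mul, mul_one, trace_sub, trace_add,
      mul_assoc, c1, c2, c3]
    ring
  have h := integral_mono_ae hi1 ((hi2.add (hint N)).sub (integrable_const _)) hpt
  rw [integral_sub' (hi2.add (hint N)) (integrable_const _), integral_add' hi2 (hint N), hmean,
    integral_const, probReal_univ, one_smul] at h
  linarith

theorem G_gaussian (hζ : 0 < ζ) (hreg : ∀ᵐ μ ∂Q, μ ∈ regularGaussians D ζ)
    {A : Matrix (Fin D) (Fin D) ℝ} (hA : A.PosDef) :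
    G Q (gaussian A) = ENNReal.ofReal (meanBuresSq Q A / 2) := by
  have hreg' : ∀ᵐ μ ∂Q, Regular ζ (covMatrix μ) := hreg.mono fun μ hμ => (regular_covMatrix hμ).1
  have h : ∫⁻ μ, W2sq (gaussian A) μ ∂Q = ENNReal.ofReal (meanBuresSq Q A) := by
    rw [meanBuresSq, ofReal_integral_eq_lintegral_ofReal (integrable_buresSq hζ hreg' hA)
      (hreg'.mono fun _ hμ => buresSq_nonneg hA hμ.1)]
    refine lintegral_congr_ae (hreg.mono fun μ hμ => ?_)
    obtain ⟨h1, h2⟩ := regular_covMatrix hμ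
    have h3 := W2sq_gaussian_gaussian hA h1.1
    rwa [← h2] at h3
  rw [G, h, div_eq_inv_mul, ENNReal.ofReal_mul (by norm_num), ENNReal.ofReal_inv_of_pos two_pos,
    one_div, ENNReal.ofReal_ofNat]

/-- No sign is assumed on `f`: the pointwise lower bound integrated in `le_G` may be negative, where
`ENNReal.ofReal` truncates it to zero. -/
theorem ofReal_integral_le_lintegral {α : Type*} {m : MeasurableSpace α} {μ : Measure α}
    {f : α → ℝ} (hf : Integrable f μ) :
    ENNReal.ofReal (∫ x, f x ∂μ) ≤ ∫⁻ x, ENNReal.ofReal (f x) ∂μ := by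
  have h1 : ∫ x, f x ∂μ ≤ ∫ x, max (f x) 0 ∂μ :=
    integral_mono hf hf.pos_part fun x => le_max_left _ _
  refine (ENNReal.ofReal_le_ofReal h1).trans (le_of_eq ?_)
  rw [ofReal_integral_eq_lintegral_ofReal hf.pos_part (.of_forall fun x => le_max_right _ _)]
  simp

/-- The first-order lower bound for the barycenter functional at a Gaussian. -/
theorem le_G (hζ : 0 < ζ) (hζ₁ : ζ ≤ 1) (hreg : ∀ᵐ μ ∂Q, μ ∈ regularGaussians D ζ)
    {A : Matrix (Fin D) (Fin D) ℝ} (hA : Regular ζ A) (b : P2 D) :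
    ENNReal.ofReal ((meanBuresSq Q A + ((1 - meanTransport Q A) * (secondMoment b - A)).trace +
      ζ * (W2sq b (gaussian A)).toReal) / 2) ≤ G Q b := by
  have hreg' : ∀ᵐ μ ∂Q, Regular ζ (covMatrix μ) := hreg.mono fun μ hμ => (regular_covMatrix hμ).1
  have hmean := integral_trace_mul_transportMatrix hζ hreg' A
  have hint := integrable_trace_mul_transportMatrix hζ hreg' A
  have hi2 := integrable_buresSq hζ hreg' hA.1
  set w := (W2sq b (gaussian A)).toReal with hw
  set N := A - secondMoment b with hN
  set c := (secondMoment b).trace - A.trace + ζ * w with hc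
  have hpt : ∀ᵐ μ ∂Q, ENNReal.ofReal (buresSq A (covMatrix μ) +
      (N * transportMatrix A (covMatrix μ)).trace + c) ≤ W2sq b μ := hreg.mono fun μ hμ => by
    obtain ⟨hμ1, hμ2⟩ := regular_covMatrix hμ
    have h := dual_le_W2sq hζ.le hμ1.1 (posDef_transportMatrix hA.1 hμ1.1)
      (transportMatrix_mul_mul hA.1 hμ1.1) (hA.transportMatrix_sub_posSemidef hζ.le hζ₁ hμ1) b
    rw [← hμ2] at h
    refine (le_of_eq ?_).trans h
    congr 1
    have c1 := Matrix.trace_mul_comm (secondMoment b) (transportMatrix A (covMatrix μ))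
    have c2 := Matrix.trace_mul_comm A (transportMatrix A (covMatrix μ))
    rw [buresSq_eq hA.1, hN, hc, sub_mul, trace_sub, sub_mul, trace_sub, one_mul, c1, c2]
    ring
  have hi3 : Integrable (fun μ => buresSq A (covMatrix μ) +
      (N * transportMatrix A (covMatrix μ)).trace) Q := hi2.add (hint N)
  have hf := hi3.add (integrable_const c)
  simp only [Pi.add_def] at hf
  have h := (ofReal_integral_le_lintegral hf).trans (lintegral_mono_ae hpt)
  rw [integral_add hi3 (integrable_const c), integral_add hi2 (hint N), hmean,
    integral_const, probReal_univ, one_smul] at h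
  rw [G, div_eq_inv_mul, ENNReal.ofReal_mul (by norm_num), ENNReal.ofReal_inv_of_pos two_pos,
    one_div, ENNReal.ofReal_ofNat]
  gcongr
  refine (le_of_eq ?_).trans h
  congr 1
  have c1 := Matrix.trace_mul_comm (secondMoment b) (meanTransport Q A)
  have c2 := Matrix.trace_mul_comm A (meanTransport Q A)
  rw [hN, hc, meanBuresSq]
  simp only [sub_mul, mul_sub, one_mul, trace_sub, c1, c2]
  ring

/-- A minimizer of the objective over the regular covariance matrices is a fixed point of
gradient descent. -/
theorem exists_meanTransport_eq_one (hζ : 0 < ζ) (hζ₁ : ζ ≤ 1)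
    (hreg : ∀ᵐ μ ∂Q, Regular ζ (covMatrix μ)) :
    ∃ B : Matrix (Fin D) (Fin D) ℝ, Regular ζ B ∧ meanTransport Q B = 1 := by
  have hne : {A : Matrix (Fin D) (Fin D) ℝ | Regular ζ A}.Nonempty :=
    ⟨1, PosDef.one, by rw [sub_self]; exact PosSemidef.zero, by rw [det_one]; exact hζ₁⟩
  obtain ⟨B, hB, hmin⟩ := (isCompact_regular hζ).exists_isMinOn hne
    (continuousOn_meanBuresSq hζ hreg)
  refine ⟨B, hB, ?_⟩
  have h1 := hmin (regular_step hζ hζ₁ hreg hB)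
  have h2 := meanBuresSq_step_le hζ hζ₁ hreg hB
  have hSt := transpose_meanTransport hreg hB.1
  simp only [Set.mem_ofPred_eq] at h1
  set H := 1 - meanTransport Q B with hH
  have hHt : Hᵀ = H := by rw [hH, transpose_sub, transpose_one, hSt]
  have h3 := (posSemidef_conj hB.sub_smul_one_posSemidef hHt).trace_nonneg
  have h4 : 0 ≤ (H * H).trace := by
    have := (posSemidef_conj PosSemidef.one hHt).trace_nonneg
    rwa [mul_one] at this
  simp only [mul_sub, sub_mul, trace_sub, mul_smul_comm, smul_mul_assoc, trace_smul, mul_one,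
    smul_eq_mul] at h3
  have h5 : (H * H).trace = 0 := by nlinarith
  have h6 : (Hᴴ * H).trace = 0 := by rwa [conjTranspose_eq_transpose_of_trivial, hHt]
  have h7 := trace_conjTranspose_mul_self_eq_zero_iff.1 h6
  exact (sub_eq_zero.1 h7).symm

/-- The Polyak-Łojasiewicz inequality. -/
theorem meanBuresSq_sub_le (hζ : 0 < ζ) (hζ₁ : ζ ≤ 1)
    (hreg : ∀ᵐ μ ∂Q, μ ∈ regularGaussians D ζ) {A B : Matrix (Fin D) (Fin D) ℝ}
    (hA : Regular ζ A) (hB : Regular ζ B) :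
    ζ ^ 2 * (meanBuresSq Q A - meanBuresSq Q B) ≤
      ((1 - meanTransport Q A) * A * (1 - meanTransport Q A)).trace := by
  have hreg' : ∀ᵐ μ ∂Q, Regular ζ (covMatrix μ) := hreg.mono fun μ hμ => (regular_covMatrix hμ).1
  have h := le_G hζ hζ₁ hreg hA (gaussian B)
  have hF := meanBuresSq_nonneg hreg' hB.1
  rw [G_gaussian hζ hreg hB.1, ENNReal.ofReal_le_ofReal_iff (by positivity),
    secondMoment_gaussian hB.1.posSemidef, W2sq_comm, W2sq_gaussian_gaussian hA.1 hB.1,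
    ENNReal.toReal_ofReal (buresSq_nonneg hA.1 hB.1), buresSq_eq_trace hA.1 hB.1] at h
  have hMAM := transportMatrix_mul_mul hA.1 hB.1
  have hgrad := gradient_lower_bound (A := A) (M := transportMatrix A B)
    (H := 1 - meanTransport Q A) hζ hζ₁ hA.1.posSemidef hA.sub_smul_one_posSemidef
    (transpose_eq_of_posDef (posDef_transportMatrix hA.1 hB.1))
    (by rw [transpose_sub, transpose_one, transpose_meanTransport hreg' hA.1])
    (by rw [hMAM]; exact hB.2.1)
  rw [hMAM] at hgrad
  rw [← le_div_iff₀' (by positivity)]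
  linarith

theorem regular_buresGD (hζ : 0 < ζ) (hζ₁ : ζ ≤ 1) (hreg : ∀ᵐ μ ∂Q, Regular ζ (covMatrix μ))
    {A : Matrix (Fin D) (Fin D) ℝ} (hA : Regular ζ A) (t : ℕ) : Regular ζ (buresGD Q A t) := by
  induction t with
  | zero => exact hA
  | succ t ih => exact regular_step hζ hζ₁ hreg ih

theorem meanBuresSq_buresGD_sub_le (hζ : 0 < ζ) (hζ₁ : ζ ≤ 1)
    (hreg : ∀ᵐ μ ∂Q, μ ∈ regularGaussians D ζ) {A B : Matrix (Fin D) (Fin D) ℝ}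
    (hA : Regular ζ A) (hB : Regular ζ B)
    (hmin : ∀ A, Regular ζ A → meanBuresSq Q B ≤ meanBuresSq Q A) (t : ℕ) :
    meanBuresSq Q (buresGD Q A t) - meanBuresSq Q B ≤
      (1 - ζ ^ 2 / 4) ^ t * (meanBuresSq Q A - meanBuresSq Q B) := by
  have hreg' : ∀ᵐ μ ∂Q, Regular ζ (covMatrix μ) := hreg.mono fun μ hμ => (regular_covMatrix hμ).1
  induction t with
  | zero => simp [buresGD]
  | succ t ih =>
    have ht := regular_buresGD hζ hζ₁ hreg' hA t
    have h1 := meanBuresSq_step_le hζ hζ₁ hreg' ht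
    have h2 := meanBuresSq_sub_le hζ hζ₁ hreg ht hB
    have h3 := hmin _ ht
    have h4 : 0 ≤ 1 - ζ ^ 2 / 4 := by nlinarith
    rw [pow_succ, mul_comm _ (1 - ζ ^ 2 / 4), mul_assoc]
    refine le_trans ?_ (mul_le_mul_of_nonneg_left ih h4)
    -- The estimates give the factor `1 - ζ ^ 2`; it is weakened to `1 - ζ ^ 2 / 4`, which is
    -- legitimate because the excess `h3` is nonnegative.
    rw [buresGD]
    nlinarith [mul_nonneg (sq_nonneg ζ) (sub_nonneg.2 h3)]

end Average

end BuresBarycenter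

/-! ### Assembly: barycenter, uniqueness and convergence rate -/

open BuresBarycenter in
theorem theorem1 (D : ℕ) (ζ : ℝ) (hζ₀ : 0 < ζ) (hζ₁ : ζ ≤ 1)
    (Q : MeasureTheory.Measure (BuresBarycenter.P2 D)) (hQ : MeasureTheory.IsProbabilityMeasure Q)
    (hreg : ∀ᵐ μ ∂Q, μ ∈ BuresBarycenter.regularGaussians D ζ) :
    ∃ bbar : BuresBarycenter.P2 D,
      BuresBarycenter.IsBarycenter Q bbar ∧
      (∀ b : BuresBarycenter.P2 D, BuresBarycenter.IsBarycenter Q b → b = bbar) ∧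
      MeasureTheory.Measure.AbsolutelyContinuous bbar.toMeasure MeasureTheory.volume ∧
      ∀ b₀ ∈ Q.support,
        -- every step of the algorithm is well defined
        (∀ t : ℕ, (BuresBarycenter.buresGD Q (BuresBarycenter.covMatrix b₀) t).PosDef ∧
          ∀ i j : Fin D, MeasureTheory.Integrable
            (fun μ => BuresBarycenter.transportMatrix
              (BuresBarycenter.buresGD Q (BuresBarycenter.covMatrix b₀) t)
              (BuresBarycenter.covMatrix μ) i j) Q) ∧
        -- the rate of convergence
        ∀ T : ℕ,
          (BuresBarycenter.W2sq (BuresBarycenter.gaussian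
            (BuresBarycenter.buresGD Q (BuresBarycenter.covMatrix b₀) T)) bbar).toReal ≤
          2 / ζ * (1 - ζ ^ 2 / 4) ^ T *
            ((BuresBarycenter.G Q b₀).toReal - (BuresBarycenter.G Q bbar).toReal) := by
  have hreg' : ∀ᵐ μ ∂Q, Regular ζ (covMatrix μ) := hreg.mono fun μ hμ => (regular_covMatrix hμ).1
  obtain ⟨B, hB, hfix⟩ := exists_meanTransport_eq_one hζ₀ hζ₁ hreg'
  have hF := meanBuresSq_nonneg hreg' hB.1
  have hGB := G_gaussian hζ₀ hreg hB.1
  -- At the fixed point the first-order term disappears, leaving quadratic growth around `gaussian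
  -- B` over all of `P2 D`, not only over Gaussians.
  have hlow : ∀ b : P2 D, ENNReal.ofReal ((meanBuresSq Q B +
      ζ * (W2sq b (gaussian B)).toReal) / 2) ≤ G Q b := fun b => by
    simpa [hfix] using le_G hζ₀ hζ₁ hreg hB b
  have hvar : ∀ A, Regular ζ A → ζ * (W2sq (gaussian A) (gaussian B)).toReal ≤
      meanBuresSq Q A - meanBuresSq Q B := fun A hA => by
    have h := hlow (gaussian A)
    have := meanBuresSq_nonneg hreg' hA.1
    rw [G_gaussian hζ₀ hreg hA.1, ENNReal.ofReal_le_ofReal_iff (by positivity)] at h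
    linarith
  -- Minimality of `B` is recovered from the growth bound, so only the fixed point equation is
  -- needed from the construction of `B`.
  have hmin : ∀ A, Regular ζ A → meanBuresSq Q B ≤ meanBuresSq Q A := fun A hA => by
    have := mul_nonneg hζ₀.le (ENNReal.toReal_nonneg (a := W2sq (gaussian A) (gaussian B)))
    linarith [hvar A hA]
  refine ⟨gaussian B, fun b => ?_, fun b hb => ?_, gaussian_absolutelyContinuous hB.1,
    fun b₀ hb₀ => ?_⟩
  · rw [hGB]
    refine (ENNReal.ofReal_le_ofReal ?_).trans (hlow b)
    have := mul_nonneg hζ₀.le (ENNReal.toReal_nonneg (a := W2sq b (gaussian B)))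
    linarith
  · have h := (hlow b).trans (hb (gaussian B))
    rw [hGB, ENNReal.ofReal_le_ofReal_iff (by positivity)] at h
    have h0 : (W2sq b (gaussian B)).toReal = 0 := by
      refine le_antisymm ?_ ENNReal.toReal_nonneg
      by_contra hlt
      push Not at hlt
      have := mul_pos hζ₀ hlt
      linarith
    exact eq_of_W2sq_eq_zero
      (((ENNReal.toReal_eq_zero_iff _).1 h0).resolve_right (W2sq_ne_top _ _))
  · obtain ⟨hA, hbA⟩ := regular_covMatrix
      (Measure.support_subset_of_isClosed (isClosed_regularGaussians hζ₀) hreg hb₀)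
    refine ⟨fun t => ⟨(regular_buresGD hζ₀ hζ₁ hreg' hA t).1,
      integrable_transportMatrix hζ₀ hreg' _⟩, fun T => ?_⟩
    have hG0 : (G Q b₀).toReal = meanBuresSq Q (covMatrix b₀) / 2 := by
      conv_lhs => rw [hbA]
      rw [G_gaussian hζ₀ hreg hA.1, ENNReal.toReal_ofReal]
      have := meanBuresSq_nonneg hreg' hA.1
      positivity
    rw [hG0, hGB, ENNReal.toReal_ofReal (by positivity)]
    have h := (hvar _ (regular_buresGD hζ₀ hζ₁ hreg' hA T)).trans
      (meanBuresSq_buresGD_sub_le hζ₀ hζ₁ hreg hA hB hmin T)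
    rw [← le_div_iff₀' hζ₀] at h
    refine h.trans (le_of_eq ?_)
    ring
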